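/- Let $K$ be a field (for example $K=\mathbb{C}$, or $K=\mathbb{C}(q,v_1,\dots,v_m)$ for the generic algebra), let $m\ge 0$ and $n\ge 1$ be integers, and let $q,v_1,\dots,v_m\in K$ satisfy $q\neq 0$, $q^2\neq 1$ and - $1+q^2+\dots+q^{2N}\neq 0$ for all integers $0\le N<n$; - $q^{2i}v_j-v_k\neq 0$ for all $j\neq k$ and all integers $i$ with $-n<i<n$; - $v_j\neq 0$ for $j=1,\dots,m$. Let $H(m,1,n)$ be the cyclotomic Hecke algebra over $K$: the associative unital algebra generated by $\tau,\sigma_1,\dots,\sigma_{n-1}$ with relations $\sigma_i\sigma_{i+1}\sigma_i=\sigma_{i+1}\sigma_i\sigma_{i+1}$, $\sigma_i\sigma_j=\sigma_j\sigma_i$ for $|i-j|>1$, $\tau\sigma_1\tau\sigma_1=\sigma_1\tau\sigma_1\tau$, $\tau\sigma_i=\sigma_i\tau$ for $i>1$, $\sigma_i^2=(q-q^{-1})\sigma_i+1$ and $(\tau-v_1)\cdots(\tau-v_m)=0$. Its Jucys–Murphy elements are $J_1=\tau$, $J_{i+1}=\sigma_iJ_i\sigma_i$. A *$C$-representation* is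 a finite-dimensional representation of $H(m,1,n)$ in which every $J_i$ acts diagonalizably and, for every $i=1,\dots,n-1$, the action of the subalgebra generated by $J_i,J_{i+1},\sigma_i$ is completely reducible. Let $\mathrm{Spec}(J_1,\dots,J_n)\subset K^n$ be the set of strings $(a_1,\dots,a_n)$ for which there is a nonzero vector $e$ in some $C$-representation with $J_ie=a_ie$ for all $i$. Let $\mathrm{Cont}_m(n)$ be the set of content strings, that is, of strings $(a_1,\dots,a_n)$ whose entries are all of the form $v_kq^{2z}$ with $1\le k\le m$, $z\in\mathbb{Z}$, $|z|<n$, and such that, where $k$ and $z$ always run over $1\le k\le m$ and the integers $|z|<n$: - (c1) $a_1\in\{v_1,\dots,v_m\}$; - (c2) for all $j>1$: if $a_j=v_kq^{2z}$ for some $k$ and some $z\neq 0$, then $\{v_kq^{2(z-1)},v_kq^{2(z+1)}\}\cap\{a_1,\dots,a_{j-1}\}\neq\varnothing$; - (c3) if $a_i=a_j=v_kq^{2z}$ with $i<j$ for some $k$ and $z$, then $\{v_kq^{2(z-1)},v_kq^{2(z+1)}\}\subset\{a_{i+1},\dots,a_{j-1}\}$. A standard $m$-tableau of size $n$ is an $m$-tuple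 of Young diagrams with $n$ nodes in total, filled bijectively with $1,\dots,n$ so that in every diagram the numbers increase along rows and down columns. Its string of contents is $(c_1,\dots,c_n)$, where $c_i=v_kq^{2(s-r)}$ if the number $i$ stands in row $r$ and column $s$ of the $k$-th diagram. Then the set $\mathrm{Spec}(J_1,\dots,J_n)$, the set $\mathrm{Cont}_m(n)$ and the set of standard $m$-tableaux of size $n$ are in pairwise bijection. More precisely, $\mathrm{Spec}(J_1,\dots,J_n)=\mathrm{Cont}_m(n)$, and the map sending a tableau to its string of contents is a bijection from the set of standard $m$-tableaux of size $n$ onto this set. -/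

import Mathlib

universe u

namespace CyclotomicHecke

/-- The generators `τ, σ₁, …, σₙ₋₁` (for `n ≥ 1`); `sigma i` stands for `σ_{i+1}`. -/
inductive Gen (n : ℕ) : Type
  | tau : Gen n
  | sigma (i : Fin (n - 1)) : Gen n

section Algebra

variable {K : Type u} [Field K]

/-- The generator `τ` of the free algebra. -/
def freeTau (K : Type u) [Field K] (n : ℕ) : FreeAlgebra K (Gen n) :=
  FreeAlgebra.ι K Gen.tau

/-- The generator `σ_{i+1}` of the free algebra. -/
def freeSigma (K : Type u) [Field K] {n : ℕ} (i : Fin (n - 1)) : FreeAlgebra K (Gen n) :=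
  FreeAlgebra.ι K (Gen.sigma i)

/-- The defining relations of the cyclotomic Hecke algebra `H(m,1,n)` with parameters
`q` and `v₁, …, vₘ`. For nonzero `q` and `vⱼ` the relations `quadratic` and `cyclotomic` make all
generators invertible, so the quotient of the free algebra by these relations is also the
quotient of the group algebra of the braid group of type B. -/
inductive Rel {m : ℕ} (n : ℕ) (q : K) (v : Fin m → K) :
    FreeAlgebra K (Gen n) → FreeAlgebra K (Gen n) → Prop
  | braid (i j : Fin (n - 1)) (h : (i : ℕ) + 1 = j) :
      Rel n q v (freeSigma K i * freeSigma K j * freeSigma K i)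
        (freeSigma K j * freeSigma K i * freeSigma K j)
  | far_comm (i j : Fin (n - 1)) (h : (i : ℕ) + 1 < j) :
      Rel n q v (freeSigma K i * freeSigma K j) (freeSigma K j * freeSigma K i)
  | tau_braid (i : Fin (n - 1)) (h : (i : ℕ) = 0) :
      Rel n q v (freeTau K n * freeSigma K i * freeTau K n * freeSigma K i)
        (freeSigma K i * freeTau K n * freeSigma K i * freeTau K n)
  | tau_comm (i : Fin (n - 1)) (h : 0 < (i : ℕ)) :
      Rel n q v (freeTau K n * freeSigma K i) (freeSigma K i * freeTau K n)
  | quadratic (i : Fin (n - 1)) :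
      Rel n q v (freeSigma K i ^ 2) ((q - q⁻¹) • freeSigma K i + 1)
  | cyclotomic :
      Rel n q v
        (List.ofFn fun k => freeTau K n - algebraMap K (FreeAlgebra K (Gen n)) (v k)).prod 0

/-- The cyclotomic Hecke algebra `H(m,1,n)` over `K` with parameters `q` and `v₁, …, vₘ`. -/
abbrev HeckeAlgebra {m : ℕ} (n : ℕ) (q : K) (v : Fin m → K) : Type u :=
  RingQuot (Rel n q v)

variable {m n : ℕ} (q : K) (v : Fin m → K)

/-- The element `τ` of `H(m,1,n)`. -/
def tau : HeckeAlgebra n q v :=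
  RingQuot.mkAlgHom K (Rel n q v) (freeTau K n)

/-- The element `σ_{i+1}` of `H(m,1,n)`. -/
def sigma (i : Fin (n - 1)) : HeckeAlgebra n q v :=
  RingQuot.mkAlgHom K (Rel n q v) (freeSigma K i)

/-- The Jucys–Murphy elements; `jucysMurphy q v i hi` is `J_{i+1}`:
`J₁ = τ` and `J_{i+2} = σ_{i+1} J_{i+1} σ_{i+1}`. -/
def jucysMurphy : (i : ℕ) → i < n → HeckeAlgebra n q v
  | 0, _ => tau q v
  | i + 1, h =>
      sigma q v ⟨i, by omega⟩ * jucysMurphy i (by omega) * sigma q v ⟨i, by omega⟩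

variable {q v}

/-- `C`-representations: all Jucys–Murphy elements act by diagonalizable operators, and for every
`i` the action of the subalgebra generated by `J_i`, `J_{i+1}` and `σ_i` is completely
reducible. -/
structure IsCRepresentation {V : Type u} [AddCommGroup V] [Module K V]
    (ρ : HeckeAlgebra n q v →ₐ[K] Module.End K V) : Prop where
  diagonalizable : ∀ (i : ℕ) (hi : i < n),
    ⨆ μ : K, Module.End.eigenspace (ρ (jucysMurphy q v i hi)) μ = ⊤
  completely_reducible : ∀ (i : ℕ) (hi : i + 1 < n),
    IsSemisimpleModule
      (Algebra.adjoin K ({ρ (jucysMurphy q v i (by omega)), ρ (jucysMurphy q v (i + 1) hi),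
        ρ (sigma q v ⟨i, by omega⟩)} : Set (Module.End K V))) V

variable (n q v)

/-- `Spec(J₁, …, Jₙ)`: the strings of joint eigenvalues of the Jucys–Murphy elements in
(finite-dimensional) `C`-representations of `H(m,1,n)`. -/
def jmSpec : Set (Fin n → K) :=
  {a | ∃ (V : Type u) (_ : AddCommGroup V) (_ : Module K V) (_ : FiniteDimensional K V)
      (ρ : HeckeAlgebra n q v →ₐ[K] Module.End K V),
      IsCRepresentation ρ ∧
        ∃ e : V, e ≠ 0 ∧ ∀ i : Fin n, ρ (jucysMurphy q v i i.isLt) e = a i • e}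

/-- Content strings of length `n`. The entries are numbers of the form `v_k q^{2z}` with `|z| < n`,
which is the range of the contents of the nodes of `m`-diagrams with `n` nodes; the exponents in
the conditions `c2` and `c3` run over the same range. -/
structure IsContentString (a : Fin n → K) : Prop where
  entries : ∀ j, ∃ (k : Fin m) (z : ℤ), |z| < n ∧ a j = v k * q ^ (2 * z)
  c1 : ∀ j : Fin n, (j : ℕ) = 0 → a j ∈ Set.range v
  c2 : ∀ j : Fin n, 0 < (j : ℕ) → ∀ (k : Fin m) (z : ℤ), |z| < n → z ≠ 0 →
    a j = v k * q ^ (2 * z) →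
      (({v k * q ^ (2 * (z - 1)), v k * q ^ (2 * (z + 1))} : Set K) ∩ a '' Set.Iio j).Nonempty
  c3 : ∀ i j : Fin n, i < j → ∀ (k : Fin m) (z : ℤ), |z| < n →
    a i = v k * q ^ (2 * z) → a j = v k * q ^ (2 * z) →
      ({v k * q ^ (2 * (z - 1)), v k * q ^ (2 * (z + 1))} : Set K) ⊆ a '' Set.Ioo i j

/-- `Cont_m(n)`, the set of content strings of length `n`. -/
def contentStrings : Set (Fin n → K) :=
  {a | IsContentString n q v a}

end Algebra

/-- Standard Young `m`-tableaux with `n` nodes: an `m`-tuple of Young diagrams whose nodes are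
numbered bijectively, increasingly along rows and down columns. `node i` is the node carrying the
number `i + 1`, given as (index of the diagram, row, column), all counted from `0`. -/
structure StandardTableau (m n : ℕ) where
  shape : Fin m → YoungDiagram
  node : Fin n → Fin m × ℕ × ℕ
  node_injective : Function.Injective node
  range_node : Set.range node = {x | x.2 ∈ shape x.1}
  row_lt : ∀ i j, (node i).1 = (node j).1 → (node i).2.1 = (node j).2.1 →
    (node i).2.2 < (node j).2.2 → i < j
  col_lt : ∀ i j, (node i).1 = (node j).1 → (node i).2.2 = (node j).2.2 →
    (node i).2.1 < (node j).2.1 → i < j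

/-- The string of contents of a standard `m`-tableau: the node in row `r` and column `s` of the
`k`-th diagram has content `v_k q^{2(s-r)}`. -/
def StandardTableau.contentString {K : Type u} [Field K] {m n : ℕ} (q : K) (v : Fin m → K)
    (T : StandardTableau m n) : Fin n → K :=
  fun i => v (T.node i).1 * q ^ (2 * (((T.node i).2.2 : ℤ) - ((T.node i).2.1 : ℤ)))

end CyclotomicHecke

/-!
In an Okounkov–Vershik style argument, let `a` be a string of joint eigenvalues of the Jucys–Murphy
elements on a `C`-representation. The operators `J_i`, `J_{i+1}`, `σ_i` satisfy the relations of a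
rank two affine Hecke algebra, so neighbouring entries of `a` are different, and they can be
exchanged by an intertwiner unless they are linked, that is, unless their quotient is `q ^ 2` or
`q ^ (-2)`. Complete reducibility makes `σ_i` act by a scalar in the linked case, and the braid
relation then excludes patterns `x, y, x` with `x` and `y` linked. Moving equal entries towards each
other by exchanges turns these local restrictions into the conditions on content strings.

Conversely, Young's seminormal formulas define a `C`-representation on the functions of content
strings, on which `J_i` multiplies by the `i`-th entry.

The strings of contents of tableaux are found by adding the largest number last: the nodes that can
be added to a tableau are determined by their contents, and these contents are exactly the entries
that prolong its string of contents to a content string.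
-/

namespace CyclotomicHecke

/-! ### Content strings -/

section Strings

variable {K : Type u} [Field K] {m n : ℕ} {q : K} {v : Fin m → K}

/-- Two contents are linked if they are contents of nodes on adjacent diagonals, that is, if one
is `q ^ 2` times the other. -/
def IsLinked (q x y : K) : Prop :=
  y = q ^ 2 * x ∨ x = q ^ 2 * y

theorem IsLinked.symm {x y : K} (h : IsLinked q x y) : IsLinked q y x :=
  Or.symm h

theorem inv_sq_mul_eq_iff (hq : q ≠ 0) {x y : K} : y = q⁻¹ ^ 2 * x ↔ x = q ^ 2 * y := by
  rw [inv_pow, eq_inv_mul_iff_mul_eq₀ (pow_ne_zero 2 hq), eq_comm]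

theorem isLinked_inv_iff (hq : q ≠ 0) {x y : K} : IsLinked q⁻¹ x y ↔ IsLinked q x y := by
  rw [IsLinked, IsLinked, inv_sq_mul_eq_iff hq, inv_sq_mul_eq_iff hq, or_comm]

theorem content_succ (hq : q ≠ 0) (x : K) (z : ℤ) :
    x * q ^ (2 * (z + 1)) = q ^ 2 * (x * q ^ (2 * z)) := by
  rw [mul_add, zpow_add₀ hq]
  norm_cast
  ring

theorem eq_content_pred_iff (hq : q ≠ 0) (x y : K) (z : ℤ) :
    y = x * q ^ (2 * (z - 1)) ↔ x * q ^ (2 * z) = q ^ 2 * y := by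
  rw [← sub_add_cancel z 1, content_succ hq, add_sub_cancel_right,
    mul_right_inj' (pow_ne_zero 2 hq), eq_comm]

theorem isLinked_content_iff (hq : q ≠ 0) (x y : K) (z : ℤ) :
    IsLinked q (x * q ^ (2 * z)) y ↔
      y = x * q ^ (2 * (z - 1)) ∨ y = x * q ^ (2 * (z + 1)) := by
  rw [IsLinked, eq_content_pred_iff hq, content_succ hq, or_comm]

/-- Genericity of the parameters for strings of length `n`: the content of a node of an
`m`-diagram with at most `n` nodes determines the diagonal of the node. The bound `|d| ≤ n` in
`zpow_ne_one` includes the distance of two nodes that can be added to a diagram with `n - 1`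
nodes. -/
structure IsGeneric (n : ℕ) (q : K) (v : Fin m → K) : Prop where
  q_ne_zero : q ≠ 0
  sq_ne_one : q ^ 2 ≠ 1
  zpow_ne_one : ∀ d : ℤ, d ≠ 0 → |d| ≤ n → q ^ (2 * d) ≠ 1
  separated : ∀ d : ℤ, |d| < n → ∀ j k : Fin m, j ≠ k → q ^ (2 * d) * v j ≠ v k
  v_ne_zero : ∀ k, v k ≠ 0

namespace IsGeneric

theorem mono {l : ℕ} (h : IsGeneric n q v) (hl : l ≤ n) : IsGeneric l q v where
  q_ne_zero := h.q_ne_zero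
  sq_ne_one := h.sq_ne_one
  zpow_ne_one d hd hdl := h.zpow_ne_one d hd (by omega)
  separated d hd := h.separated d (by omega)
  v_ne_zero := h.v_ne_zero

theorem of_sum_ne_zero (hq0 : q ≠ 0) (hq1 : q ^ 2 ≠ 1)
    (hsum : ∀ N : ℕ, N < n → ∑ i ∈ Finset.range (N + 1), q ^ (2 * i) ≠ 0)
    (hsep : ∀ i : ℤ, -(n : ℤ) < i → i < (n : ℤ) → ∀ j k : Fin m, j ≠ k →
      q ^ (2 * i) * v j - v k ≠ 0)
    (hv : ∀ j : Fin m, v j ≠ 0) : IsGeneric n q v where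
  q_ne_zero := hq0
  sq_ne_one := hq1
  v_ne_zero := hv
  separated d hd j k hjk h := hsep d (abs_lt.1 hd).1 (abs_lt.1 hd).2 j k hjk (sub_eq_zero.2 h)
  zpow_ne_one := by
    have pow_ne_one (N : ℕ) (hN : N < n) : q ^ (2 * (N + 1)) ≠ 1 := fun h => by
      have hgeom := geom_sum_mul (q ^ 2) (N + 1)
      simp only [← pow_mul, h, sub_self] at hgeom
      exact hsum N hN ((mul_eq_zero.1 hgeom).resolve_right (sub_ne_zero.2 hq1))
    intro d hd hdn h
    obtain ⟨N, hN⟩ : ∃ N, d.natAbs = N + 1 := Nat.exists_eq_succ_of_ne_zero (by omega)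
    refine pow_ne_one N (by rw [Int.abs_eq_natAbs] at hdn; omega) ?_
    rcases Int.natAbs_eq d with hd' | hd' <;> rw [hd', hN] at h
    · exact_mod_cast h
    · rw [mul_neg, zpow_neg, inv_eq_one] at h
      exact_mod_cast h

theorem eq_of_content_eq (h : IsGeneric n q v) {k k' : Fin m} {z z' : ℤ}
    (hk : k = k' → |z - z'| ≤ n) (hk' : k ≠ k' → |z - z'| < n)
    (e : v k * q ^ (2 * z) = v k' * q ^ (2 * z')) : k = k' ∧ z = z' := by
  have e' : q ^ (2 * (z - z')) * v k = v k' := by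
    rw [mul_sub, zpow_sub₀ h.q_ne_zero, div_mul_eq_mul_div, div_eq_iff (zpow_ne_zero _ h.q_ne_zero),
      ← e, mul_comm]
  by_cases hkk : k = k'
  · subst hkk
    refine ⟨rfl, ?_⟩
    by_contra hz
    exact h.zpow_ne_one (z - z') (sub_ne_zero.2 hz) (hk rfl)
      (mul_right_cancel₀ (h.v_ne_zero k) (e'.trans (one_mul _).symm))
  · exact absurd e' (h.separated _ (hk' hkk) k k' hkk)

theorem sub_inv_ne_zero (h : IsGeneric n q v) : q - q⁻¹ ≠ 0 := fun h0 =>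
  h.sq_ne_one (by rw [pow_two, mul_eq_one_iff_eq_inv₀ h.q_ne_zero, ← sub_eq_zero, h0])

theorem one_add_sq_ne_zero (h : IsGeneric n q v) (hn : 2 ≤ n) : 1 + q ^ 2 ≠ 0 := by
  intro h0
  refine h.zpow_ne_one 2 (by norm_num) (by simpa using hn) ?_
  calc q ^ (2 * 2 : ℤ) = 1 + (1 + q ^ 2) * (q ^ 2 - 1) := by norm_cast; ring
    _ = 1 := by rw [h0, zero_mul, add_zero]

end IsGeneric

/-- Content strings, described without reference to the form of the entries: every entry is a
parameter or is linked to an earlier entry, and between two equal entries both values linked to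
them occur. -/
structure IsLocalContent (q : K) (v : Fin m → K) (a : Fin n → K) : Prop where
  start : ∀ j, a j ∈ Set.range v ∨ ∃ i < j, IsLinked q (a i) (a j)
  gap : ∀ i j, i < j → a i = a j →
    (∃ k ∈ Set.Ioo i j, a k = q ^ 2 * a i) ∧ ∃ k ∈ Set.Ioo i j, a i = q ^ 2 * a k

namespace IsLocalContent

variable {a : Fin n → K}

theorem exists_entry (ha : IsLocalContent q v a) (hq : q ≠ 0) (j : Fin n) :
    ∃ (k : Fin m) (z : ℤ), |z| ≤ (j : ℕ) ∧ a j = v k * q ^ (2 * z) := by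
  induction j using WellFoundedLT.induction with | ind j ih
  rcases ha.start j with ⟨k, hk⟩ | ⟨i, hij, hlink⟩
  · exact ⟨k, 0, by simp, by simp [hk]⟩
  · obtain ⟨k, z, hz, hi⟩ := ih i hij
    have hij' : (i : ℕ) < j := hij
    rw [hi, isLinked_content_iff hq] at hlink
    rcases hlink with hj | hj
    · exact ⟨k, z - 1, by rw [abs_le] at hz ⊢; omega, hj⟩
    · exact ⟨k, z + 1, by rw [abs_le] at hz ⊢; omega, hj⟩

theorem ne_zero (ha : IsLocalContent q v a) (hq : q ≠ 0) (hv : ∀ k, v k ≠ 0) (j : Fin n) :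
    a j ≠ 0 := by
  obtain ⟨k, z, -, hj⟩ := ha.exists_entry hq j
  rw [hj]
  exact mul_ne_zero (hv k) (zpow_ne_zero _ hq)

theorem isContentString (ha : IsLocalContent q v a) (hg : IsGeneric n q v) :
    IsContentString n q v a where
  entries j := by
    obtain ⟨k, z, hz, hj⟩ := ha.exists_entry hg.q_ne_zero j
    exact ⟨k, z, by omega, hj⟩
  c1 j hj := (ha.start j).resolve_right fun ⟨i, hij, _⟩ => by
    have : (i : ℕ) < j := hij
    omega
  c2 j _ k z hz hz0 hj := by
    rcases ha.start j with ⟨k', hk'⟩ | ⟨i, hij, hlink⟩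
    · refine absurd (hg.eq_of_content_eq (k := k) (k' := k') (z := z) (z' := 0) ?_ ?_ ?_).2 hz0
      · exact fun _ => by simpa using hz.le
      · exact fun _ => by simpa using hz
      · rw [← hj, ← hk', mul_zero, zpow_zero, mul_one]
    · exact ⟨a i, (isLinked_content_iff hg.q_ne_zero _ _ _).1 (hj ▸ hlink.symm), i, hij, rfl⟩
  c3 i j hij k z _ hi hj := by
    obtain ⟨⟨p, hp, hap⟩, r, hr, har⟩ := ha.gap i j hij (hi.trans hj.symm)
    rintro _ (rfl | rfl)
    · exact ⟨r, hr, (eq_content_pred_iff hg.q_ne_zero _ _ _).2 (hi ▸ har)⟩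
    · exact ⟨p, hp, by rw [content_succ hg.q_ne_zero, hap, hi]⟩

end IsLocalContent

theorem IsContentString.isLocalContent {a : Fin n → K} (ha : IsContentString n q v a)
    (hq : q ≠ 0) : IsLocalContent q v a where
  start j := by
    obtain ⟨k, z, hz, hj⟩ := ha.entries j
    by_cases hz0 : z = 0
    · exact Or.inl ⟨k, by simp [hj, hz0]⟩
    · rcases Nat.eq_zero_or_pos (j : ℕ) with hj0 | hj0
      · exact Or.inl (ha.c1 j hj0)
      · obtain ⟨_, hlink, i, hij, rfl⟩ := ha.c2 j hj0 k z hz hz0 hj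
        exact Or.inr ⟨i, hij, (hj ▸ (isLinked_content_iff hq _ _ _).2 hlink).symm⟩
  gap i j hij hij' := by
    obtain ⟨k, z, hz, hi⟩ := ha.entries i
    have hsub := ha.c3 i j hij k z hz hi (hij' ▸ hi)
    obtain ⟨r, hr, har⟩ := hsub (Set.mem_insert _ _)
    obtain ⟨p, hp, hap⟩ := hsub (Set.mem_insert_of_mem _ rfl)
    exact ⟨⟨p, hp, by rw [hap, content_succ hq, hi]⟩,
      r, hr, by rw [hi]; exact (eq_content_pred_iff hq _ _ _).1 har⟩

theorem contentStrings_eq (hg : IsGeneric n q v) :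
    contentStrings n q v = {a | IsLocalContent q v a} :=
  Set.ext fun _ => ⟨fun h => h.isLocalContent hg.q_ne_zero, fun h => h.isContentString hg⟩

end Strings

/-! ### Standard tableaux -/

section Tableaux

variable {m n : ℕ} {node : Fin n → Fin m × ℕ × ℕ} {x y : Fin m × ℕ × ℕ}

/-- The numberings of nodes that come from standard `m`-tableaux: no node occurs twice, and the
nodes weakly above and to the left of a node come before it. -/
structure IsStandard (node : Fin n → Fin m × ℕ × ℕ) : Prop where
  injective : Function.Injective node
  exists_le : ∀ j, ∀ x ≤ (node j).2, ∃ i ≤ j, node i = ((node j).1, x)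

/-- A node that can be numbered next: it is new, but all nodes weakly above and to the left of it
are present. -/
def IsAddable (node : Fin n → Fin m × ℕ × ℕ) (x : Fin m × ℕ × ℕ) : Prop :=
  x ∉ Set.range node ∧ ∀ y < x.2, (x.1, y) ∈ Set.range node

/-- The nodes of the first row strictly to the left of the column of `x`, and the nodes of the
first column strictly above its row, are present. This holds for present and for addable nodes,
and suffices to bound their contents by counting. -/
def IsFramed (node : Fin n → Fin m × ℕ × ℕ) (x : Fin m × ℕ × ℕ) : Prop :=
  (∀ s < x.2.2, (x.1, 0, s) ∈ Set.range node) ∧ ∀ r < x.2.1, (x.1, r, 0) ∈ Set.range node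

theorem IsAddable.isFramed (hx : IsAddable node x) : IsFramed node x :=
  ⟨fun s hs => hx.2 (0, s) (Prod.lt_iff.2 (Or.inr ⟨Nat.zero_le _, hs⟩)),
    fun r hr => hx.2 (r, 0) (Prod.lt_iff.2 (Or.inl ⟨hr, Nat.zero_le _⟩))⟩

namespace IsStandard

theorem mem_range_of_le (h : IsStandard node) (hy : y ∈ Set.range node) (hk : x.1 = y.1)
    (hxy : x.2 ≤ y.2) : x ∈ Set.range node := by
  obtain ⟨j, rfl⟩ := hy
  obtain ⟨i, -, hi⟩ := h.exists_le j x.2 hxy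
  exact ⟨i, hi.trans (Prod.ext hk.symm rfl)⟩

theorem le_of_le (h : IsStandard node) {i j : Fin n} (hk : (node i).1 = (node j).1)
    (hij : (node i).2 ≤ (node j).2) : i ≤ j := by
  obtain ⟨p, hp, hpi⟩ := h.exists_le j _ hij
  rwa [h.injective (hpi.trans (Prod.ext hk.symm rfl))] at hp

theorem lt_of_lt (h : IsStandard node) {i j : Fin n} (hk : (node i).1 = (node j).1)
    (hij : (node i).2 < (node j).2) : i < j :=
  (h.le_of_le hk hij.le).lt_of_ne fun e => hij.ne (by rw [e])

theorem isFramed (h : IsStandard node) (hx : x ∈ Set.range node) : IsFramed node x :=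
  ⟨fun _ hs => h.mem_range_of_le hx rfl ⟨Nat.zero_le _, hs.le⟩,
    fun _ hr => h.mem_range_of_le hx rfl ⟨hr.le, Nat.zero_le _⟩⟩

end IsStandard

theorem isStandard_snoc :
    IsStandard (Fin.snoc node x : Fin (n + 1) → Fin m × ℕ × ℕ) ↔
      IsStandard node ∧ IsAddable node x := by
  constructor
  · intro h
    have hinj := Fin.snoc_injective_iff.1 h.injective
    refine ⟨⟨hinj.1, fun j y hy => ?_⟩, hinj.2, fun y hy => ?_⟩
    · obtain ⟨i, hij, hi⟩ := h.exists_le j.castSucc y (by simpa using hy)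
      obtain ⟨i, rfl⟩ := Fin.exists_castSucc_eq.2 (hij.trans_lt j.castSucc_lt_last).ne
      exact ⟨i, by simpa using hij, by simpa using hi⟩
    · obtain ⟨i, -, hi⟩ := h.exists_le (Fin.last n) y (by simpa using hy.le)
      cases i using Fin.lastCases with
      | last => exact absurd (congrArg Prod.snd hi) (by simpa using hy.ne')
      | cast i => exact ⟨i, by simpa using hi⟩
  · rintro ⟨h, hx⟩
    refine ⟨Fin.snoc_injective_iff.2 ⟨h.injective, hx.1⟩, fun j y hy => ?_⟩
    cases j using Fin.lastCases with
    | last =>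
      rw [Fin.snoc_last] at hy ⊢
      rcases hy.eq_or_lt with rfl | hy
      · exact ⟨Fin.last n, le_rfl, Fin.snoc_last _ _⟩
      · obtain ⟨i, hi⟩ := hx.2 y hy
        exact ⟨i.castSucc, i.castSucc_lt_last.le, by simpa using hi⟩
    | cast j =>
      obtain ⟨i, hij, hi⟩ := h.exists_le j y (by simpa using hy)
      exact ⟨i.castSucc, by simpa using hij, by simpa using hi⟩

theorem row_add_col_le {k k' : Fin m} {r s : ℕ} (hs : ∀ t < s, (k, 0, t) ∈ Set.range node)
    (hr : ∀ t < r, (k', t, 0) ∈ Set.range node) : s + r ≤ n + if k = k' then 1 else 0 := by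
  set c := if k = k' then 1 else 0 with hc
  -- The corner lies in both the row and the column if `k = k'`, so the column is counted from `c`.
  let hook : Fin s ⊕ Fin (r - c) → Fin m × ℕ × ℕ :=
    Sum.elim (fun t => (k, 0, t)) fun t => (k', t + c, 0)
  have hook_injective : Function.Injective hook := by
    rintro (t | t) (t' | t') e <;>
      simp only [hook, Sum.elim_inl, Sum.elim_inr, Prod.mk.injEq] at e
    · exact congrArg Sum.inl (Fin.ext e.2.2)
    · simp [hc, e.1] at e
    · simp [hc, e.1] at e
    · exact congrArg Sum.inr (Fin.ext (by omega))
  have hook_mem : ∀ p, ∃ i, node i = hook p := by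
    rintro (t | t)
    · exact hs t t.2
    · exact hr (t + c) (by omega)
  choose f hf using hook_mem
  have hcard := Fintype.card_le_of_injective f
    (.of_comp (f := node) (by rwa [show node ∘ f = hook from funext hf]))
  rw [Fintype.card_sum, Fintype.card_fin, Fintype.card_fin, Fintype.card_fin] at hcard
  omega

variable {K : Type u} [Field K] {q : K} {v : Fin m → K}

/-- The content of the node in row `x.2.1` and column `x.2.2` of the `x.1`-th diagram. -/
def nodeContent (q : K) (v : Fin m → K) (x : Fin m × ℕ × ℕ) : K :=
  v x.1 * q ^ (2 * ((x.2.2 : ℤ) - (x.2.1 : ℤ)))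

theorem nodeContent_right (hq : q ≠ 0) (k : Fin m) (r s : ℕ) :
    nodeContent q v (k, r, s + 1) = q ^ 2 * nodeContent q v (k, r, s) := by
  rw [nodeContent, nodeContent, ← content_succ hq]
  congr 3
  push_cast
  ring

theorem nodeContent_down (hq : q ≠ 0) (k : Fin m) (r s : ℕ) :
    nodeContent q v (k, r, s) = q ^ 2 * nodeContent q v (k, r + 1, s) := by
  rw [nodeContent, nodeContent, ← content_succ hq]
  congr 3
  push_cast
  ring

theorem nodeContent_diag (k : Fin m) (r s : ℕ) :
    nodeContent q v (k, r + 1, s + 1) = nodeContent q v (k, r, s) := by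
  simp [nodeContent]

theorem IsFramed.eq_of_nodeContent_eq (hg : IsGeneric (n + 1) q v) (hx : IsFramed node x)
    (hy : IsFramed node y) (e : nodeContent q v x = nodeContent q v y) :
    x.1 = y.1 ∧ x.2.2 + y.2.1 = y.2.2 + x.2.1 := by
  have hxy := row_add_col_le hx.1 hy.2
  have hyx := row_add_col_le hy.1 hx.2
  obtain ⟨hk, hz⟩ := hg.eq_of_content_eq
    (fun hk => by
      rw [if_pos hk] at hxy
      rw [if_pos hk.symm] at hyx
      rw [abs_le]
      omega)
    (fun hk => by
      rw [if_neg hk] at hxy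
      rw [if_neg (Ne.symm hk)] at hyx
      rw [abs_lt]
      omega) e
  exact ⟨hk, by omega⟩

/-- The condition on `c` for a string of local contents `a`, followed by `c`, to be a string of
local contents again. -/
structure IsExtension (q : K) (v : Fin m → K) (a : Fin n → K) (c : K) : Prop where
  start : c ∈ Set.range v ∨ ∃ i, IsLinked q (a i) c
  gap : ∀ i, a i = c → (∃ k > i, a k = q ^ 2 * c) ∧ ∃ k > i, c = q ^ 2 * a k

theorem isLocalContent_snoc {a : Fin n → K} {c : K} :
    IsLocalContent q v (Fin.snoc a c : Fin (n + 1) → K) ↔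
      IsLocalContent q v a ∧ IsExtension q v a c := by
  have last_not_lt (j : Fin n) : ¬Fin.last n < j.castSucc := j.castSucc_lt_last.not_gt
  constructor
  · intro h
    refine ⟨⟨fun j => ?_, fun i j hij e => ?_⟩, ?_, fun i e => ?_⟩
    · simpa [Fin.exists_fin_succ', last_not_lt] using h.start j.castSucc
    · simpa [Fin.exists_fin_succ', last_not_lt] using
        h.gap i.castSucc j.castSucc hij (by simpa using e)
    · simpa [Fin.exists_fin_succ'] using h.start (Fin.last n)
    · simpa [Fin.exists_fin_succ', e] using
        h.gap i.castSucc (Fin.last n) i.castSucc_lt_last (by simpa using e)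
  · rintro ⟨h, h'⟩
    refine ⟨fun j => ?_, fun i j hij e => ?_⟩
    · cases j using Fin.lastCases with
      | last => simpa [Fin.exists_fin_succ'] using h'.start
      | cast j => simpa [Fin.exists_fin_succ', last_not_lt] using h.start j
    · cases j using Fin.lastCases with
      | last =>
        obtain ⟨i, rfl⟩ := Fin.exists_castSucc_eq.2 hij.ne
        rw [Fin.snoc_castSucc, Fin.snoc_last] at e
        simpa [Fin.exists_fin_succ', e] using h'.gap i e
      | cast j =>
        obtain ⟨i, rfl⟩ := Fin.exists_castSucc_eq.2 (hij.trans j.castSucc_lt_last).ne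
        simpa [Fin.exists_fin_succ', last_not_lt] using h.gap i j hij (by simpa using e)

theorem IsAddable.isExtension (hg : IsGeneric (n + 1) q v) (h : IsStandard node)
    (hx : IsAddable node x) : IsExtension q v (nodeContent q v ∘ node) (nodeContent q v x) := by
  obtain ⟨k, r, s⟩ := x
  refine ⟨?_, fun i e => ?_⟩
  · match r, s with
    | 0, 0 => exact Or.inl ⟨k, by simp [nodeContent]⟩
    | r, s + 1 =>
      obtain ⟨i, hi⟩ := hx.2 (r, s) (by simp [Prod.lt_iff])
      exact Or.inr ⟨i, Or.inl (by simp [hi, nodeContent_right hg.q_ne_zero])⟩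
    | r + 1, 0 =>
      obtain ⟨i, hi⟩ := hx.2 (r, 0) (by simp [Prod.lt_iff])
      exact Or.inr ⟨i, Or.inr (by simp [hi, ← nodeContent_down hg.q_ne_zero])⟩
  · obtain ⟨hk, hd⟩ := (h.isFramed ⟨i, rfl⟩).eq_of_nodeContent_eq hg hx.isFramed e
    have hr : (node i).2.1 < r := by
      by_contra! hr
      exact hx.1 (h.mem_range_of_le ⟨i, rfl⟩ hk.symm ⟨hr, by dsimp only at hd ⊢; omega⟩)
    rcases hi : node i with ⟨k', r', s'⟩
    simp only [hi, Function.comp_apply] at e hk hd hr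
    subst hk
    obtain ⟨p, hp⟩ := hx.2 (r', s' + 1) (Prod.mk_lt_mk.2 (by omega))
    obtain ⟨p', hp'⟩ := hx.2 (r' + 1, s') (Prod.mk_lt_mk.2 (by omega))
    refine ⟨⟨p, h.lt_of_lt (by rw [hi, hp]) (by simp [hi, hp]), ?_⟩,
      p', h.lt_of_lt (by rw [hi, hp']) (by simp [hi, hp']), ?_⟩
    · simp [hp, nodeContent_right hg.q_ne_zero, e]
    · simp [hp', ← nodeContent_down hg.q_ne_zero, e]

/-- The last hypothesis places `y` weakly above and to the left of the diagonal neighbour of the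
earlier node `node i`, which keeps `node p` from preceding `y` on their common diagonal. -/
theorem IsStandard.mem_range_of_nodeContent_eq (hg : IsGeneric (n + 1) q v) (h : IsStandard node)
    {i p : Fin n} (hip : i < p) (hk : y.1 = (node i).1) (hy : IsFramed node y)
    (e : nodeContent q v (node p) = nodeContent q v y)
    (hle : y.2 ≤ (node i).2 + (1, 1)) : y ∈ Set.range node := by
  obtain ⟨hk', hd⟩ := (h.isFramed ⟨p, rfl⟩).eq_of_nodeContent_eq hg hy e
  obtain ⟨hr, hs⟩ := Prod.le_def.1 hle
  simp only [Prod.fst_add, Prod.snd_add] at hr hs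
  by_cases hyp : y.2.1 ≤ (node p).2.1
  · exact h.mem_range_of_le ⟨p, rfl⟩ hk'.symm ⟨hyp, by omega⟩
  · exact absurd (h.le_of_le (hk'.trans hk) ⟨by omega, by omega⟩) hip.not_ge

theorem IsExtension.exists_isAddable_of_mem (hg : IsGeneric (n + 1) q v) (h : IsStandard node)
    {c : K} (hc : IsExtension q v (nodeContent q v ∘ node) c)
    (hmem : c ∈ Set.range (nodeContent q v ∘ node)) :
    ∃ x, IsAddable node x ∧ nodeContent q v x = c := by
  obtain ⟨i, hmax⟩ := (Set.toFinite {i | nodeContent q v (node i) = c}).exists_maximal hmem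
  rcases hi : node i with ⟨k, r, s⟩
  have hic : nodeContent q v (k, r, s) = c := hi ▸ hmax.prop
  have hframed : IsFramed node (k, r, s) := h.isFramed ⟨i, hi⟩
  obtain ⟨⟨p, hip, hp⟩, p', hip', hp'⟩ := hc.gap i hmax.prop
  have hright : (k, r, s + 1) ∈ Set.range node := by
    refine h.mem_range_of_nodeContent_eq hg hip (by rw [hi]) ⟨fun t ht => ?_, hframed.2⟩ ?_
      (by simp [hi])
    · exact h.mem_range_of_le ⟨i, hi⟩ rfl ⟨Nat.zero_le _, Nat.le_of_lt_succ ht⟩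
    · rw [nodeContent_right hg.q_ne_zero, hic, ← hp, Function.comp_apply]
  have hdown : (k, r + 1, s) ∈ Set.range node := by
    refine h.mem_range_of_nodeContent_eq hg hip' (by rw [hi]) ⟨hframed.1, fun t ht => ?_⟩ ?_
      (by simp [hi])
    · exact h.mem_range_of_le ⟨i, hi⟩ rfl ⟨Nat.le_of_lt_succ ht, Nat.zero_le _⟩
    · refine mul_left_cancel₀ (pow_ne_zero 2 hg.q_ne_zero) ?_
      rw [← nodeContent_down hg.q_ne_zero, hic, hp', Function.comp_apply]
  refine ⟨(k, r + 1, s + 1), ⟨?_, ?_⟩, (nodeContent_diag k r s).trans hic⟩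
  · rintro ⟨t, ht⟩
    refine hmax.not_gt (y := t) ?_ (h.lt_of_lt (by rw [hi, ht]) (by simp [hi, ht, Prod.lt_iff]))
    rw [Set.mem_ofPred_eq, ht, nodeContent_diag, hic]
  · rintro ⟨r', s'⟩ hlt
    rw [Prod.mk_lt_mk] at hlt
    rcases Nat.lt_or_ge s s' with hs | hs
    · exact h.mem_range_of_le hright rfl (Prod.mk_le_mk.2 (by omega))
    · exact h.mem_range_of_le hdown rfl (Prod.mk_le_mk.2 (by omega))

theorem IsExtension.exists_isAddable_of_notMem (hq : q ≠ 0) (h : IsStandard node)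
    {c : K} (hc : IsExtension q v (nodeContent q v ∘ node) c)
    (hmem : c ∉ Set.range (nodeContent q v ∘ node)) :
    ∃ x, IsAddable node x ∧ nodeContent q v x = c := by
  have notMem {x} (hx : nodeContent q v x = c) : x ∉ Set.range node :=
    fun ⟨i, hi⟩ => hmem ⟨i, by simp [hi, hx]⟩
  rcases hc.start with ⟨k, rfl⟩ | ⟨i, hi⟩
  · have hx : nodeContent q v (k, 0, 0) = v k := by simp [nodeContent]
    exact ⟨_, ⟨notMem hx, fun y hy => absurd hy not_lt_bot⟩, hx⟩
  rcases hnode : node i with ⟨k, r, s⟩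
  have mem {r' s' : ℕ} (hle : r' ≤ r ∧ s' ≤ s) : (k, r', s') ∈ Set.range node :=
    h.mem_range_of_le ⟨i, hnode⟩ rfl hle
  rw [Function.comp_apply, hnode, IsLinked] at hi
  rcases hi with hi | hi
  · have hx : nodeContent q v (k, r, s + 1) = c := by rw [nodeContent_right hq, hi]
    have hr : r = 0 := by
      by_contra hr
      obtain ⟨r, rfl⟩ := Nat.exists_eq_succ_of_ne_zero hr
      exact notMem ((nodeContent_diag k r s).symm.trans hx) (mem ⟨r.le_succ, le_rfl⟩)
    subst hr
    exact ⟨_, ⟨notMem hx, fun y hy => mem (by simp only [Prod.lt_iff] at hy; omega)⟩, hx⟩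
  · have hx : nodeContent q v (k, r + 1, s) = c :=
      mul_left_cancel₀ (pow_ne_zero 2 hq) ((nodeContent_down hq k r s).symm.trans hi)
    have hs : s = 0 := by
      by_contra hs
      obtain ⟨s, rfl⟩ := Nat.exists_eq_succ_of_ne_zero hs
      exact notMem ((nodeContent_diag k r s).symm.trans hx) (mem ⟨le_rfl, s.le_succ⟩)
    subst hs
    exact ⟨_, ⟨notMem hx, fun y hy => mem (by simp only [Prod.lt_iff] at hy; omega)⟩, hx⟩

theorem IsExtension.exists_isAddable (hg : IsGeneric (n + 1) q v) (h : IsStandard node) {c : K}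
    (hc : IsExtension q v (nodeContent q v ∘ node) c) :
    ∃ x, IsAddable node x ∧ nodeContent q v x = c := by
  by_cases hmem : c ∈ Set.range (nodeContent q v ∘ node)
  · exact hc.exists_isAddable_of_mem hg h hmem
  · exact hc.exists_isAddable_of_notMem hg.q_ne_zero h hmem

theorem IsAddable.eq_of_nodeContent_eq (hg : IsGeneric (n + 1) q v) (hx : IsAddable node x)
    (hy : IsAddable node y) (e : nodeContent q v x = nodeContent q v y) : x = y := by
  obtain ⟨hk, hd⟩ := hx.isFramed.eq_of_nodeContent_eq hg hy.isFramed e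
  rcases lt_trichotomy x.2.1 y.2.1 with hlt | heq | hlt
  · refine absurd (hy.2 x.2 (Prod.lt_iff.2 (by omega))) ?_
    rw [← hk]
    exact hx.1
  · exact Prod.ext hk (Prod.ext heq (by omega))
  · refine absurd (hx.2 y.2 (Prod.lt_iff.2 (by omega))) ?_
    rw [hk]
    exact hy.1

theorem IsStandard.isLocalContent (hg : IsGeneric n q v) (h : IsStandard node) :
    IsLocalContent q v (nodeContent q v ∘ node) := by
  induction node using Fin.snocInduction with
  | elim0 => exact ⟨fun j => j.elim0, fun i => i.elim0⟩
  | snoc node x ih =>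
    rw [isStandard_snoc] at h
    rw [Fin.comp_snoc, isLocalContent_snoc]
    exact ⟨ih (hg.mono (Nat.le_succ _)) h.1, h.2.isExtension hg h.1⟩

theorem IsLocalContent.exists_isStandard (hg : IsGeneric n q v) {a : Fin n → K}
    (ha : IsLocalContent q v a) :
    ∃ node : Fin n → Fin m × ℕ × ℕ, IsStandard node ∧ nodeContent q v ∘ node = a := by
  induction a using Fin.snocInduction with
  | elim0 => exact ⟨Fin.elim0, ⟨fun i => i.elim0, fun j => j.elim0⟩, Subsingleton.elim _ _⟩
  | snoc a c ih =>
    rw [isLocalContent_snoc] at ha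
    obtain ⟨node, h, rfl⟩ := ih (hg.mono (Nat.le_succ _)) ha.1
    obtain ⟨x, hx, rfl⟩ := ha.2.exists_isAddable hg h
    exact ⟨Fin.snoc node x, isStandard_snoc.2 ⟨h, hx⟩, Fin.comp_snoc _ _ _⟩

theorem IsStandard.eq_of_nodeContent_eq (hg : IsGeneric n q v) (h : IsStandard node)
    {node' : Fin n → Fin m × ℕ × ℕ} (h' : IsStandard node')
    (e : nodeContent q v ∘ node = nodeContent q v ∘ node') : node = node' := by
  induction node using Fin.snocInduction with
  | elim0 => exact Subsingleton.elim _ _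
  | snoc node x ih =>
    cases node' using Fin.snocCases with | _ node' x'
    rw [isStandard_snoc] at h h'
    rw [Fin.comp_snoc, Fin.comp_snoc, Fin.snoc_inj] at e
    obtain rfl := ih (hg.mono (Nat.le_succ _)) h.1 h'.1 e.1
    rw [h.2.eq_of_nodeContent_eq hg h'.2 e.2]

namespace StandardTableau

theorem mem_shape_iff (T : StandardTableau m n) (x : Fin m × ℕ × ℕ) :
    x.2 ∈ T.shape x.1 ↔ x ∈ Set.range T.node := by
  rw [T.range_node, Set.mem_ofPred_eq]

theorem isStandard_node (T : StandardTableau m n) : IsStandard T.node where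
  injective := T.node_injective
  exists_le j x hx := by
    have le_of_row {i j : Fin n} (hk : (T.node i).1 = (T.node j).1)
        (hr : (T.node i).2.1 = (T.node j).2.1) (hs : (T.node i).2.2 ≤ (T.node j).2.2) : i ≤ j :=
      hs.lt_or_eq.elim (fun hs => (T.row_lt i j hk hr hs).le)
        fun hs => (T.node_injective (Prod.ext hk (Prod.ext hr hs))).le
    have le_of_col {i j : Fin n} (hk : (T.node i).1 = (T.node j).1)
        (hs : (T.node i).2.2 = (T.node j).2.2) (hr : (T.node i).2.1 ≤ (T.node j).2.1) : i ≤ j :=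
      hr.lt_or_eq.elim (fun hr => (T.col_lt i j hk hs hr).le)
        fun hr => (T.node_injective (Prod.ext hk (Prod.ext hr hs))).le
    have exists_node (y : ℕ × ℕ) (hy : y ≤ (T.node j).2) : ∃ i, T.node i = ((T.node j).1, y) :=
      (T.mem_shape_iff ((T.node j).1, y)).1
        ((T.shape _).isLowerSet hy ((T.mem_shape_iff _).2 ⟨j, rfl⟩))
    obtain ⟨i, hi⟩ := exists_node x hx
    obtain ⟨p, hp⟩ := exists_node (x.1, (T.node j).2.2) ⟨hx.1, le_rfl⟩
    have hip : i ≤ p := le_of_row (by rw [hi, hp]) (by rw [hi, hp]) (by rw [hi, hp]; exact hx.2)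
    have hpj : p ≤ j := le_of_col (by rw [hp]) (by rw [hp]) (by rw [hp]; exact hx.1)
    exact ⟨i, hip.trans hpj, hi⟩

theorem eq_of_node_eq {T T' : StandardTableau m n} (h : T.node = T'.node) : T = T' := by
  have hshape : T.shape = T'.shape := by
    funext k
    ext x
    rw [YoungDiagram.mem_cells, YoungDiagram.mem_cells, T.mem_shape_iff (k, x),
      T'.mem_shape_iff (k, x), h]
  cases T
  cases T'
  congr

/-- The standard tableau with a given numbering of nodes. -/
def ofNode (node : Fin n → Fin m × ℕ × ℕ) (h : IsStandard node) : StandardTableau m n where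
  shape k :=
    { cells := (Finset.univ.filter fun i => (node i).1 = k).image fun i => (node i).2
      isLowerSet := by
        intro y x hxy hy
        simp only [Finset.coe_image, Finset.coe_filter, Finset.mem_univ, true_and, Set.mem_image,
          Set.mem_ofPred_eq] at hy ⊢
        obtain ⟨j, rfl, rfl⟩ := hy
        obtain ⟨i, -, hi⟩ := h.exists_le j x hxy
        exact ⟨i, by rw [hi], by rw [hi]⟩ }
  node := node
  node_injective := h.injective
  range_node := by
    ext ⟨k, x⟩
    simp only [Set.mem_range, Set.mem_ofPred_eq, YoungDiagram.mem_mk, Finset.mem_image,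
      Finset.mem_filter, Finset.mem_univ, true_and]
    exact exists_congr fun i => Prod.ext_iff
  row_lt _ _ hk hr hs := h.lt_of_lt hk (Prod.lt_iff.2 (Or.inr ⟨hr.le, hs⟩))
  col_lt _ _ hk hs hr := h.lt_of_lt hk (Prod.lt_iff.2 (Or.inl ⟨hr, hs.le⟩))

theorem bijOn_contentString (hg : IsGeneric n q v) :
    Set.BijOn (contentString q v) (Set.univ : Set (StandardTableau m n))
      {a | IsLocalContent q v a} := by
  refine ⟨fun T _ => T.isStandard_node.isLocalContent hg, fun T _ T' _ e => ?_, fun a ha => ?_⟩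
  · exact eq_of_node_eq (T.isStandard_node.eq_of_nodeContent_eq hg T'.isStandard_node e)
  · obtain ⟨node, h, e⟩ := ha.exists_isStandard hg
    exact ⟨ofNode node h, trivial, e⟩

end StandardTableau

end Tableaux

/-! ### Relations in the Hecke algebra -/

section Relations

theorem commute_of_braid {M : Type*} [Monoid M] {s t x : M} (hst : s * t * s = t * s * t)
    (hx : Commute t x) : Commute s (t * (s * x * s) * t) :=
  calc s * (t * (s * x * s) * t) = s * t * s * x * s * t := by simp only [mul_assoc]
    _ = t * s * (t * x) * s * t := by rw [hst]; simp only [mul_assoc]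
    _ = t * s * x * (t * s * t) := by rw [hx.eq]; simp only [mul_assoc]
    _ = t * (s * x * s) * t * s := by rw [← hst]; simp only [mul_assoc]

variable {K : Type u} [Field K] {m n : ℕ} (q : K) (v : Fin m → K)

theorem sigma_braid {i j : Fin (n - 1)} (h : (i : ℕ) + 1 = j) :
    sigma q v i * sigma q v j * sigma q v i = sigma q v j * sigma q v i * sigma q v j := by
  simpa only [sigma, map_mul] using
    RingQuot.mkAlgHom_rel K (Rel.braid (q := q) (v := v) i j h)

theorem sigma_commute {i j : Fin (n - 1)} (h : (i : ℕ) + 1 < j) :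
    Commute (sigma q v i) (sigma q v j) := by
  simpa only [sigma, map_mul, commute_iff_eq] using
    RingQuot.mkAlgHom_rel K (Rel.far_comm (q := q) (v := v) i j h)

theorem tau_commute {i : Fin (n - 1)} (h : 0 < (i : ℕ)) : Commute (tau q v) (sigma q v i) := by
  simpa only [tau, sigma, map_mul, commute_iff_eq] using
    RingQuot.mkAlgHom_rel K (Rel.tau_comm (q := q) (v := v) i h)

theorem sigma_mul_self (i : Fin (n - 1)) :
    sigma q v i * sigma q v i = (q - q⁻¹) • sigma q v i + 1 := by
  simpa only [sigma, pow_two, map_mul, map_add, map_smul, map_one] using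
    RingQuot.mkAlgHom_rel K (Rel.quadratic (q := q) (v := v) i)

theorem prod_tau_sub : (List.ofFn fun k =>
    tau q v - algebraMap K (HeckeAlgebra n q v) (v k)).prod = 0 := by
  have hrel := RingQuot.mkAlgHom_rel K (Rel.cyclotomic (n := n) (q := q) (v := v))
  rw [map_zero, map_list_prod, List.map_ofFn] at hrel
  rw [← hrel]
  congr 2
  funext k
  simp only [Function.comp_apply, map_sub, AlgHom.commutes]
  rfl

theorem jucysMurphy_succ {i : ℕ} (h : i + 1 < n) : jucysMurphy q v (i + 1) h =
    sigma q v ⟨i, by omega⟩ * jucysMurphy q v i (by omega) * sigma q v ⟨i, by omega⟩ :=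
  rfl

theorem sigma_commute_jucysMurphy_of_lt {i : Fin (n - 1)} {k : ℕ} (hk : k < n) (hki : k < i) :
    Commute (sigma q v i) (jucysMurphy q v k hk) := by
  induction k with
  | zero => exact (tau_commute q v hki).symm
  | succ k ih =>
    have hs : Commute (sigma q v i) (sigma q v ⟨k, by omega⟩) := (sigma_commute q v hki).symm
    exact (hs.mul_right (ih _ (by omega))).mul_right hs

theorem sigma_commute_jucysMurphy_of_gt {i : Fin (n - 1)} {k : ℕ} (hk : k < n)
    (hik : (i : ℕ) + 2 ≤ k) : Commute (sigma q v i) (jucysMurphy q v k hk) := by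
  induction k, hik using Nat.le_induction with
  | base =>
    exact commute_of_braid (sigma_braid q v (j := ⟨i + 1, by omega⟩) rfl)
      (sigma_commute_jucysMurphy_of_lt q v _ (Nat.lt_succ_self i))
  | succ k hik ih =>
    have hs : Commute (sigma q v i) (sigma q v ⟨k, by omega⟩) := sigma_commute q v hik
    exact (hs.mul_right (ih _)).mul_right hs

theorem sigma_commute_jucysMurphy {i : Fin (n - 1)} {k : ℕ} (hk : k < n) (h0 : k ≠ i)
    (h1 : k ≠ i + 1) : Commute (sigma q v i) (jucysMurphy q v k hk) := by
  rcases lt_or_gt_of_ne h0 with h | h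
  · exact sigma_commute_jucysMurphy_of_lt q v hk h
  · exact sigma_commute_jucysMurphy_of_gt q v hk (by omega)

end Relations

/-! ### Modules over algebras of endomorphisms -/

section Endomorphisms

open Module (End)

theorem mem_invtSubmodule_of_mem_adjoin {R V : Type*} [CommSemiring R] [AddCommMonoid V]
    [Module R V] {s : Set (End R V)} {U : Submodule R V} (hU : ∀ T ∈ s, U ∈ T.invtSubmodule)
    {T : End R V} (hT : T ∈ Algebra.adjoin R s) : U ∈ T.invtSubmodule := by
  simp only [End.mem_invtSubmodule_iff_forall_mem_of_mem] at hU ⊢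
  induction hT using Algebra.adjoin_induction with
  | mem T hT => exact hU T hT
  | algebraMap r => exact fun x hx => U.smul_mem r hx
  | add _ _ _ _ h h' => exact fun x hx => U.add_mem (h x hx) (h' x hx)
  | mul _ _ _ _ h h' => exact fun x hx => h _ (h' x hx)

theorem restrictScalars_mem_invtSubmodule {R V : Type*} [CommSemiring R] [AddCommMonoid V]
    [Module R V] {s : Set (End R V)} (U : Submodule (Algebra.adjoin R s) V) {T : End R V}
    (hT : T ∈ s) : U.restrictScalars R ∈ T.invtSubmodule :=
  fun _ hx => U.smul_mem (⟨T, Algebra.subset_adjoin hT⟩ : Algebra.adjoin R s) hx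

theorem exists_isCompl_of_isSemisimpleModule_adjoin {R V : Type*} [CommRing R] [AddCommGroup V]
    [Module R V] {s : Set (End R V)} (hss : IsSemisimpleModule (Algebra.adjoin R s) V)
    {U : Submodule R V} (hU : ∀ T ∈ s, U ∈ T.invtSubmodule) :
    ∃ W : Submodule R V, (∀ T ∈ s, W ∈ T.invtSubmodule) ∧ IsCompl U W := by
  let U' : Submodule (Algebra.adjoin R s) V :=
    { U with smul_mem' := fun T _ hx => mem_invtSubmodule_of_mem_adjoin hU T.2 hx }
  obtain ⟨W, hW⟩ := exists_isCompl U'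
  exact ⟨W.restrictScalars R, fun T hT => restrictScalars_mem_invtSubmodule W hT,
    (Submodule.isCompl_restrictScalars_iff R).2 hW⟩

theorem isSemisimpleModule_adjoin_of_span_eq_top {R V : Type*} [CommRing R] [AddCommGroup V]
    [Module R V] {s : Set (End R V)} {E : Set V} (hE : Submodule.span R E = ⊤)
    (hsimple : ∀ e ∈ E, IsSimpleModule (Algebra.adjoin R s)
      (Submodule.span (Algebra.adjoin R s) {e})) :
    IsSemisimpleModule (Algebra.adjoin R s) V := by
  refine isSemisimpleModule_of_isSemisimpleModule_submodule'
    (p := fun e : E => Submodule.span (Algebra.adjoin R s) {(e : V)})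
    (fun e => have := hsimple e e.2; inferInstance) ?_
  rw [← Submodule.span_range_eq_iSup, Subtype.range_coe, eq_top_iff]
  exact fun x _ => Submodule.span_le_restrictScalars R _ E (hE ▸ Submodule.mem_top (x := x))

theorem isSimpleModule_span_singleton_adjoin {R V : Type*} [CommRing R] [AddCommGroup V]
    [Module R V] {s : Set (End R V)} {e : V} (he : e ≠ 0) {Q : Submodule R V} (heQ : e ∈ Q)
    (hQ : ∀ T ∈ s, Q ∈ T.invtSubmodule)
    (hgen : ∀ N : Submodule R V, (∀ T ∈ s, N ∈ T.invtSubmodule) → ∀ f ∈ Q, f ∈ N → f ≠ 0 →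
      e ∈ N) :
    IsSimpleModule (Algebra.adjoin R s) (Submodule.span (Algebra.adjoin R s) {e}) := by
  rw [isSimpleModule_iff_isAtom]
  refine ⟨fun h => he (Submodule.span_singleton_eq_bot.1 h), fun N hN => ?_⟩
  by_contra hbot
  obtain ⟨f, hfN, hf0⟩ := (Submodule.ne_bot_iff _).1 hbot
  refine hN.not_ge ((Submodule.span_singleton_le_iff_mem _ _).2 ?_)
  obtain ⟨T, rfl⟩ := Submodule.mem_span_singleton.1 (hN.le hfN)
  exact hgen (N.restrictScalars R) (fun T hT => restrictScalars_mem_invtSubmodule N hT) _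
    (mem_invtSubmodule_of_mem_adjoin hQ T.2 heQ) hfN hf0

theorem apply_eq_smul_of_sub_mem_eigenspace {R V : Type*} [CommRing R] [AddCommGroup V]
    [Module R V] [IsDomain R] [Module.IsTorsionFree R V] {X : End R V}
    (hX : ⨆ μ, X.eigenspace μ = ⊤) {b : R} {w : V} (hw : X w - b • w ∈ X.eigenspace b) :
    X w = b • w := by
  have heig := (X.independent_maxGenEigenspace.le_iff_eq_of_iSup_eq_top hX).1
    fun μ => (X.genEigenspace μ).mono le_top
  rw [← End.mem_eigenspace_iff, congrFun heig b, End.mem_maxGenEigenspace]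
  refine ⟨2, ?_⟩
  rw [pow_two, Module.End.mul_apply]
  simpa [sub_eq_zero] using End.mem_eigenspace_iff.1 hw

end Endomorphisms

/-! ### The intertwining operator -/

section Intertwiner

variable {K : Type u} [Field K] {q : K}

/-- The coefficient of `e` in `σ_i e`, for a joint eigenvector `e` of `J_i` and `J_{i+1}` with
eigenvalues `x` and `y`, in Young's seminormal form. -/
def diagCoeff (q x y : K) : K :=
  (q - q⁻¹) * y / (y - x)

theorem diagCoeff_mul_sub {x y : K} (h : x ≠ y) : diagCoeff q x y * (y - x) = (q - q⁻¹) * y :=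
  div_mul_cancel₀ _ (sub_ne_zero.2 h.symm)

theorem diagCoeff_add_swap {x y : K} (h : x ≠ y) :
    diagCoeff q x y + diagCoeff q y x = q - q⁻¹ := by
  rw [diagCoeff, diagCoeff, ← neg_sub y x, div_neg, ← sub_eq_add_neg, ← sub_div, ← mul_sub,
    mul_div_cancel_right₀ _ (sub_ne_zero.2 h.symm)]

theorem mul_diagCoeff_add_swap (x y : K) : x * diagCoeff q x y + y * diagCoeff q y x = 0 := by
  rw [diagCoeff, diagCoeff, ← neg_sub y x, div_neg]
  ring

theorem one_add_diagCoeff_mul_swap (hq : q ≠ 0) {x y : K} (h : x ≠ y) :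
    1 + diagCoeff q x y * diagCoeff q y x =
      (q⁻¹ * (y - q ^ 2 * x) / (y - x)) * (q⁻¹ * (x - q ^ 2 * y) / (x - y)) := by
  have hyx : y - x ≠ 0 := sub_ne_zero.2 h.symm
  have hxy : x - y ≠ 0 := sub_ne_zero.2 h
  rw [diagCoeff, diagCoeff]
  field_simp
  ring

theorem one_add_diagCoeff_mul_swap_eq_zero_iff (hq : q ≠ 0) {x y : K} (h : x ≠ y) :
    1 + diagCoeff q x y * diagCoeff q y x = 0 ↔ IsLinked q x y := by
  rw [one_add_diagCoeff_mul_swap hq h]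
  simp only [mul_eq_zero, div_eq_zero_iff, inv_eq_zero, hq, sub_eq_zero, h, h.symm, false_or,
    or_false, IsLinked]

variable {V : Type*} [AddCommGroup V] [Module K V] {S X : Module.End K V} {e : V} {a b : K}

theorem apply_apply_of_mul_self {r : K} (hS : S * S = r • S + 1) (x : V) :
    S (S x) = r • S x + x :=
  LinearMap.congr_fun hS x

/-- The image of `e` under the operator intertwining the eigenvalues of `X` and `S * X * S`. -/
def intertwine (q : K) (S : Module.End K V) (a b : K) (e : V) : V :=
  S e - diagCoeff q a b • e

theorem apply_apply_of_conj_apply (hS : S * S = (q - q⁻¹) • S + 1) (hY : (S * X * S) e = b • e) :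
    X (S e) = b • S e - ((q - q⁻¹) * b) • e := by
  have hSS := apply_apply_of_mul_self hS (X (S e))
  rw [show S (X (S e)) = b • e from hY, map_smul] at hSS
  rw [hSS, smul_smul]
  abel

theorem apply_intertwine (hS : S * S = (q - q⁻¹) • S + 1) (hX : X e = a • e)
    (hY : (S * X * S) e = b • e) (hab : a ≠ b) :
    X (intertwine q S a b e) = b • intertwine q S a b e := by
  rw [intertwine, map_sub, map_smul, hX, apply_apply_of_conj_apply hS hY, ← diagCoeff_mul_sub hab]
  module

theorem conj_apply_intertwine (hS : S * S = (q - q⁻¹) • S + 1) (hX : X e = a • e)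
    (hY : (S * X * S) e = b • e) (hab : a ≠ b) :
    (S * X * S) (intertwine q S a b e) = a • intertwine q S a b e := by
  have hYS : (S * X * S) (S e) = a • S e + ((q - q⁻¹) * b) • e := by
    rw [Module.End.mul_apply, Module.End.mul_apply, apply_apply_of_mul_self hS, map_add, map_smul,
      map_add, map_smul, hX, map_smul, show S (X (S e)) = b • e from hY, smul_smul]
    abel
  rw [intertwine, map_sub, map_smul, hY, hYS, ← diagCoeff_mul_sub hab]
  module

theorem self_apply_intertwine (hS : S * S = (q - q⁻¹) • S + 1) (hab : a ≠ b) :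
    S (intertwine q S a b e) =
      diagCoeff q b a • intertwine q S a b e + (1 + diagCoeff q a b * diagCoeff q b a) • e := by
  rw [intertwine, map_sub, map_smul, apply_apply_of_mul_self hS, ← diagCoeff_add_swap hab]
  module

theorem isLinked_of_intertwine_eq_zero (hq : q ≠ 0) (hS : S * S = (q - q⁻¹) • S + 1)
    (hab : a ≠ b) (he : e ≠ 0) (h : intertwine q S a b e = 0) : IsLinked q a b := by
  have hself := self_apply_intertwine (e := e) hS hab
  rw [h, map_zero, smul_zero, zero_add, eq_comm, smul_eq_zero_iff_left he] at hself
  exact (one_add_diagCoeff_mul_swap_eq_zero_iff hq hab).1 hself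

theorem intertwine_eq_zero_of_isLinked (hq : q ≠ 0) (hS : S * S = (q - q⁻¹) • S + 1)
    (hss : IsSemisimpleModule (Algebra.adjoin K {X, S * X * S, S}) V) (hX : X e = a • e)
    (hY : (S * X * S) e = b • e) (hab : a ≠ b) (hlink : IsLinked q a b) :
    intertwine q S a b e = 0 := by
  set f := intertwine q S a b e with hf
  have hXf : X f = b • f := apply_intertwine hS hX hY hab
  have hYf : (S * X * S) f = a • f := conj_apply_intertwine hS hX hY hab
  have hSf : S f = diagCoeff q b a • f := by
    rw [hf, self_apply_intertwine hS hab,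
      (one_add_diagCoeff_mul_swap_eq_zero_iff hq hab).2 hlink, zero_smul, add_zero]
  have span_mem {T : Module.End K V} {t : K} (h : T f = t • f) :
      Submodule.span K {f} ∈ T.invtSubmodule := by
    rw [Module.End.mem_invtSubmodule, Submodule.span_singleton_le_iff_mem, Submodule.mem_comap, h]
    exact Submodule.smul_mem _ _ (Submodule.mem_span_singleton_self f)
  obtain ⟨W, hW, hcompl⟩ := exists_isCompl_of_isSemisimpleModule_adjoin hss
    (U := Submodule.span K {f}) (by
      rintro T (rfl | rfl | rfl)
      exacts [span_mem hXf, span_mem hYf, span_mem hSf])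
  have hXW : ∀ w ∈ W, X w ∈ W := hW X (by simp)
  have hSW : ∀ w ∈ W, S w ∈ W := hW S (by simp)
  have heW : e ∈ W := by
    obtain ⟨t, w, hw, hew⟩ : ∃ t : K, ∃ w ∈ W, t • f + w = e := by
      obtain ⟨y, hy, w, hw, hyw⟩ := Submodule.mem_sup.1
        (hcompl.sup_eq_top ▸ Submodule.mem_top (x := e))
      obtain ⟨t, rfl⟩ := Submodule.mem_span_singleton.1 hy
      exact ⟨t, w, hw, hyw⟩
    have hdiff : (b - a) • e = b • w - X w := by
      rw [sub_smul, ← hX, ← hew, map_add, map_smul, hXf]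
      module
    refine (W.smul_mem_iff (sub_ne_zero.2 hab.symm)).1 ?_
    rw [hdiff]
    exact W.sub_mem (W.smul_mem b hw) (hXW w hw)
  exact Submodule.disjoint_def.1 hcompl.disjoint f (Submodule.mem_span_singleton_self f)
    (W.sub_mem (hSW e heW) (W.smul_mem _ heW))

theorem span_pair_intertwine_mem_invtSubmodule (hS : S * S = (q - q⁻¹) • S + 1) (hX : X e = a • e)
    (hY : (S * X * S) e = b • e) (hab : a ≠ b) :
    ∀ T ∈ ({X, S * X * S, S} : Set (Module.End K V)),
      Submodule.span K {e, intertwine q S a b e} ∈ T.invtSubmodule := by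
  set f := intertwine q S a b e with hf
  have hXf : X f = b • f := apply_intertwine hS hX hY hab
  have hYf : (S * X * S) f = a • f := conj_apply_intertwine hS hX hY hab
  have hSe : S e = diagCoeff q a b • e + (1 : K) • f := by
    rw [one_smul, hf, intertwine, add_sub_cancel]
  have hSf := (self_apply_intertwine (e := e) hS hab).trans (add_comm _ _)
  have pair_mem {T : Module.End K V} (h : ∃ s t : K, T e = s • e + t • f)
      (h' : ∃ s t : K, T f = s • e + t • f) : Submodule.span K {e, f} ∈ T.invtSubmodule := by
    rw [Module.End.mem_invtSubmodule, Submodule.span_le]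
    rintro _ (rfl | rfl)
    · obtain ⟨s, t, h⟩ := h
      exact Submodule.mem_span_pair.2 ⟨s, t, h.symm⟩
    · obtain ⟨s, t, h⟩ := h'
      exact Submodule.mem_span_pair.2 ⟨s, t, h.symm⟩
  rintro T (rfl | rfl | rfl)
  · exact pair_mem ⟨a, 0, by simp [hX]⟩ ⟨0, b, by simp [hXf]⟩
  · exact pair_mem ⟨b, 0, by simp [hY]⟩ ⟨0, a, by simp [hYf]⟩
  · exact pair_mem ⟨_, _, hSe⟩ ⟨_, _, hSf⟩

theorem isSimpleModule_span_of_eigenvector (hq : q ≠ 0) (hS : S * S = (q - q⁻¹) • S + 1)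
    (he : e ≠ 0) (hX : X e = a • e) (hY : (S * X * S) e = b • e) (hab : a ≠ b)
    (hlink : IsLinked q a b → intertwine q S a b e = 0) :
    IsSimpleModule (Algebra.adjoin K {X, S * X * S, S})
      (Submodule.span (Algebra.adjoin K {X, S * X * S, S}) {e}) := by
  refine isSimpleModule_span_singleton_adjoin he (Submodule.mem_span_of_mem (by simp))
    (span_pair_intertwine_mem_invtSubmodule hS hX hY hab) fun N hN g hg hgN hg0 => ?_
  set f := intertwine q S a b e
  have hXf : X f = b • f := apply_intertwine hS hX hY hab
  have hXN : ∀ w ∈ N, X w ∈ N := hN X (by simp)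
  have hSN : ∀ w ∈ N, S w ∈ N := hN S (by simp)
  obtain ⟨s, t, rfl⟩ := Submodule.mem_span_pair.1 hg
  rcases eq_or_ne s 0 with rfl | hs
  · rw [zero_smul, zero_add] at hgN hg0
    obtain ⟨ht, hf0⟩ := smul_ne_zero_iff.1 hg0
    have hfN : f ∈ N := (N.smul_mem_iff ht).1 hgN
    have hcoeff := mt (one_add_diagCoeff_mul_swap_eq_zero_iff hq hab).1 (mt hlink hf0)
    refine (N.smul_mem_iff hcoeff).1 ?_
    rw [← add_sub_cancel_left (diagCoeff q b a • f) (_ • e), ← self_apply_intertwine hS hab]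
    exact N.sub_mem (hSN f hfN) (N.smul_mem _ hfN)
  · refine (N.smul_mem_iff (mul_ne_zero (sub_ne_zero.2 hab) hs)).1 ?_
    have hdiff : ((a - b) * s) • e = X (s • e + t • f) - b • (s • e + t • f) := by
      rw [map_add, map_smul, map_smul, hX, hXf]
      module
    rw [hdiff]
    exact N.sub_mem (hXN _ hgN) (N.smul_mem _ hgN)

end Intertwiner

/-! ### Sets of strings closed under admissible transpositions -/

section Combinatorics

variable {K : Type u} [Field K] {m n : ℕ} {q : K} {v : Fin m → K} {W : Set (Fin n → K)}

/-- A set of strings which is stable under admissible transpositions, those of neighbouring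
entries that are not linked, and whose members avoid the segments `x, x` and `x, y, x` with `x`
and `y` linked. The spectrum of the Jucys–Murphy elements is such a set. -/
structure IsTranspositionClosed (q : K) (v : Fin m → K) (W : Set (Fin n → K)) : Prop where
  start : ∀ a ∈ W, ∀ j : Fin n, (j : ℕ) = 0 → a j ∈ Set.range v
  ne_succ : ∀ a ∈ W, ∀ i j : Fin n, (i : ℕ) + 1 = j → a i ≠ a j
  swap_mem : ∀ a ∈ W, ∀ i j : Fin n, (i : ℕ) + 1 = j → ¬ IsLinked q (a i) (a j) →
    a ∘ Equiv.swap i j ∈ W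
  not_isLinked : ∀ a ∈ W, ∀ i j k : Fin n, (i : ℕ) + 1 = j → (j : ℕ) + 1 = k → a i = a k →
    ¬ IsLinked q (a i) (a j)

namespace IsTranspositionClosed

theorem inv (hW : IsTranspositionClosed q v W) (hq : q ≠ 0) :
    IsTranspositionClosed q⁻¹ v W where
  start := hW.start
  ne_succ := hW.ne_succ
  swap_mem := by simpa only [isLinked_inv_iff hq] using hW.swap_mem
  not_isLinked := by simpa only [isLinked_inv_iff hq] using hW.not_isLinked

theorem mem_range_or_exists_isLinked (hW : IsTranspositionClosed q v W) {a : Fin n → K}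
    (ha : a ∈ W) (j : Fin n) : a j ∈ Set.range v ∨ ∃ i < j, IsLinked q (a i) (a j) := by
  obtain ⟨l, hl⟩ : ∃ l : ℕ, (j : ℕ) = l := ⟨_, rfl⟩
  induction l generalizing a j with
  | zero => exact Or.inl (hW.start a ha j hl)
  | succ l ih =>
    let i : Fin n := ⟨l, by omega⟩
    have hij : i < j := Fin.lt_def.2 (by simp only [i]; omega)
    by_cases hlink : IsLinked q (a i) (a j)
    · exact Or.inr ⟨i, hij, hlink⟩
    rcases ih (hW.swap_mem a ha i j hl.symm hlink) i rfl with h | ⟨p, hp, h⟩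
    · exact Or.inl (by simpa using h)
    · refine Or.inr ⟨p, hp.trans hij, ?_⟩
      simpa [Equiv.swap_apply_of_ne_of_ne hp.ne (hp.trans hij).ne] using h

theorem eq_sq_mul_pred (hW : IsTranspositionClosed q v W) {i p j : Fin n} (hip : i < p)
    (hpj : (p : ℕ) + 1 = j)
    (hgap : ∀ b ∈ W, b i = b p → ∃ k ∈ Set.Ioo i p, b k = q ^ 2 * b i) {a : Fin n → K}
    (ha : a ∈ W) (hij : a i = a j) (hno : ∀ k ∈ Set.Ioo i j, a k ≠ q ^ 2 * a i) :
    a i = q ^ 2 * a p := by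
  have hpj' : p < j := Fin.lt_def.2 (by omega)
  by_cases hlink : IsLinked q (a i) (a p)
  · exact hlink.resolve_left (hno p ⟨hip, hpj'⟩)
  have hfix : Equiv.swap p j i = i := Equiv.swap_apply_of_ne_of_ne hip.ne (hip.trans hpj').ne
  obtain ⟨k, ⟨hik, hkp⟩, hk⟩ := hgap _ (hW.swap_mem a ha p j hpj fun h => hlink (hij ▸ h.symm))
    (by simp [hfix, hij])
  rw [Function.comp_apply, Function.comp_apply, hfix,
    Equiv.swap_apply_of_ne_of_ne hkp.ne (hkp.trans hpj').ne] at hk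
  exact absurd hk (hno k ⟨hik, hkp.trans hpj'⟩)

theorem eq_sq_mul_succ (hW : IsTranspositionClosed q v W) {i s j : Fin n}
    (his : (i : ℕ) + 1 = s) (hsj : s < j)
    (hgap : ∀ b ∈ W, b s = b j → ∃ k ∈ Set.Ioo s j, b k = q ^ 2 * b s) {a : Fin n → K}
    (ha : a ∈ W) (hij : a i = a j) (hno : ∀ k ∈ Set.Ioo i j, a k ≠ q ^ 2 * a i) :
    a i = q ^ 2 * a s := by
  have his' : i < s := Fin.lt_def.2 (by omega)
  by_cases hlink : IsLinked q (a i) (a s)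
  · exact hlink.resolve_left (hno s ⟨his', hsj⟩)
  obtain ⟨k, ⟨hsk, hkj⟩, hk⟩ := hgap _ (hW.swap_mem a ha i s his hlink)
    (by simp [Equiv.swap_apply_of_ne_of_ne (his'.trans hsj).ne' hsj.ne', hij])
  rw [Function.comp_apply, Function.comp_apply, Equiv.swap_apply_right,
    Equiv.swap_apply_of_ne_of_ne (his'.trans hsk).ne' hsk.ne'] at hk
  exact absurd hk (hno k ⟨his'.trans hsk, hkj⟩)

/- For equal entries at minimal distance without `q ^ 2 * a i` in between, transpositions show
that both inner neighbours equal `q⁻¹ ^ 2 * a i`. Either they coincide, which is excluded, or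
between them there is a further entry equal to `a i`, against minimality. -/
theorem exists_eq_sq_mul (hW : IsTranspositionClosed q v W) (hq : q ≠ 0) {a : Fin n → K}
    (ha : a ∈ W) {i j : Fin n} (hij : i < j) (e : a i = a j) :
    ∃ k ∈ Set.Ioo i j, a k = q ^ 2 * a i := by
  obtain ⟨d, hd⟩ : ∃ d : ℕ, (i : ℕ) + d = j := ⟨j - i, by have : (i : ℕ) < j := hij; omega⟩
  induction d using Nat.strong_induction_on generalizing a i j with | _ d ih
  have gap_of_lt {b : Fin n → K} (hb : b ∈ W) {r t : Fin n} (hrt : r < t)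
      (hlt : (t : ℕ) - r < d) (e : b r = b t) : ∃ k ∈ Set.Ioo r t, b k = q ^ 2 * b r :=
    ih (t - r) hlt hb hrt e (by have : (r : ℕ) < t := hrt; omega)
  by_contra! hno
  have hsucc : (i : ℕ) + 1 ≠ j := fun h => hW.ne_succ a ha i j h e
  let p : Fin n := ⟨j - 1, by omega⟩
  let s : Fin n := ⟨i + 1, by omega⟩
  have hip : i < p := Fin.lt_def.2 (by simp only [p]; omega)
  have hpj : p < j := Fin.lt_def.2 (by simp only [p]; omega)
  have his : i < s := Fin.lt_def.2 (by simp only [s]; omega)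
  have hsj : s < j := Fin.lt_def.2 (by simp only [s]; omega)
  have hp : a i = q ^ 2 * a p := hW.eq_sq_mul_pred hip (by simp only [p]; omega)
    (fun b hb => gap_of_lt hb hip (by simp only [p]; omega)) ha e hno
  have hs : a i = q ^ 2 * a s := hW.eq_sq_mul_succ rfl hsj
    (fun b hb => gap_of_lt hb hsj (by simp only [s]; omega)) ha e hno
  rcases lt_or_ge s p with hsp | hps
  · obtain ⟨k, ⟨hsk, hkp⟩, hk⟩ := gap_of_lt ha hsp (by simp only [p, s]; omega)
      (mul_left_cancel₀ (pow_ne_zero 2 hq) (hs.symm.trans hp))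
    obtain ⟨l, ⟨hil, hlk⟩, hl⟩ := gap_of_lt ha (his.trans hsk) (by omega) (hs.trans hk.symm)
    exact hno l ⟨hil, hlk.trans (hkp.trans hpj)⟩ hl
  · rw [Fin.le_def] at hps
    rw [Fin.lt_def] at hsj
    simp only [p, s] at hps hsj
    exact hW.not_isLinked a ha i s j rfl (by simp only [s]; omega) e (Or.inr hs)

theorem isLocalContent (hW : IsTranspositionClosed q v W) (hq : q ≠ 0) {a : Fin n → K}
    (ha : a ∈ W) : IsLocalContent q v a where
  start := hW.mem_range_or_exists_isLinked ha
  gap i j hij e := by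
    refine ⟨hW.exists_eq_sq_mul hq ha hij e, ?_⟩
    simpa only [inv_sq_mul_eq_iff hq] using
      (hW.inv hq).exists_eq_sq_mul (inv_ne_zero hq) ha hij e

end IsTranspositionClosed

end Combinatorics

/-! ### Eigenvalues of the Jucys–Murphy elements -/

section Representations

variable {K : Type u} [Field K] {m n : ℕ} {q : K} {v : Fin m → K}
  {V : Type*} [AddCommGroup V] [Module K V] {ρ : HeckeAlgebra n q v →ₐ[K] Module.End K V}

theorem map_sigma_mul_self (ρ : HeckeAlgebra n q v →ₐ[K] Module.End K V) (i : Fin (n - 1)) :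
    ρ (sigma q v i) * ρ (sigma q v i) = (q - q⁻¹) • ρ (sigma q v i) + 1 := by
  rw [← map_mul, sigma_mul_self, map_add, map_smul, map_one]

theorem map_jucysMurphy_succ (ρ : HeckeAlgebra n q v →ₐ[K] Module.End K V) {i j : Fin n}
    (hij : (i : ℕ) + 1 = j) : ρ (jucysMurphy q v j j.isLt) =
      ρ (sigma q v ⟨i, by omega⟩) * ρ (jucysMurphy q v i i.isLt) *
        ρ (sigma q v ⟨i, by omega⟩) := by
  obtain ⟨j, hj⟩ := j
  obtain rfl : (i : ℕ) + 1 = j := hij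
  rw [jucysMurphy_succ, map_mul, map_mul]

theorem map_sigma_injective (ρ : HeckeAlgebra n q v →ₐ[K] Module.End K V) (i : Fin (n - 1)) :
    Function.Injective (ρ (sigma q v i)) := by
  refine (injective_iff_map_eq_zero _).2 fun x hx => ?_
  simpa [hx] using (apply_apply_of_mul_self (map_sigma_mul_self ρ i) x).symm

theorem prod_ofFn_sub_apply {l : ℕ} (T : Module.End K V) (w : Fin l → K) {e : V} {c : K}
    (h : T e = c • e) : (List.ofFn fun k => T - algebraMap K (Module.End K V) (w k)).prod e =
      (∏ k, (c - w k)) • e := by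
  induction l with
  | zero => simp
  | succ l ih =>
    rw [List.ofFn_succ, List.prod_cons, Module.End.mul_apply, ih, Fin.prod_univ_succ, map_smul,
      LinearMap.sub_apply, h, Module.algebraMap_end_apply, ← sub_smul, smul_smul, mul_comm]

theorem tau_eigenvalue_mem_range {e : V} (he : e ≠ 0) {c : K} (h : ρ (tau q v) e = c • e) :
    c ∈ Set.range v := by
  have hprod := congrArg (fun x => ρ x e) (prod_tau_sub (n := n) q v)
  simp only [map_list_prod, List.map_ofFn, Function.comp_def, map_sub, AlgHom.commutes,
    map_zero, LinearMap.zero_apply] at hprod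
  rw [prod_ofFn_sub_apply _ _ h, smul_eq_zero_iff_left he] at hprod
  obtain ⟨k, -, hk⟩ := Finset.prod_eq_zero_iff.1 hprod
  exact ⟨k, (sub_eq_zero.1 hk).symm⟩

theorem jucysMurphy_injective (hv : ∀ k, v k ≠ 0) (i : ℕ) (hi : i < n) :
    Function.Injective (ρ (jucysMurphy q v i hi)) := by
  induction i with
  | zero =>
    refine (injective_iff_map_eq_zero _).2 fun x hx => by_contra fun h0 => ?_
    obtain ⟨k, hk⟩ := tau_eigenvalue_mem_range h0 (hx.trans (zero_smul K x).symm)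
    exact hv k hk
  | succ i ih =>
    rw [jucysMurphy_succ, map_mul, map_mul]
    exact ((map_sigma_injective ρ _).comp (ih _)).comp (map_sigma_injective ρ _)

/-- A joint eigenvector of the Jucys–Murphy elements, with string of eigenvalues `a`. -/
structure IsWeightVector (ρ : HeckeAlgebra n q v →ₐ[K] Module.End K V) (a : Fin n → K) (e : V) :
    Prop where
  ne_zero : e ≠ 0
  apply_eq : ∀ i : Fin n, ρ (jucysMurphy q v i i.isLt) e = a i • e

namespace IsWeightVector

variable {a : Fin n → K} {e : V}

theorem eigenvalue_zero_mem_range (he : IsWeightVector ρ a e) {j : Fin n} (hj : (j : ℕ) = 0) :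
    a j ∈ Set.range v := by
  refine tau_eigenvalue_mem_range (ρ := ρ) he.ne_zero ?_
  obtain ⟨j, hj'⟩ := j
  obtain rfl : j = 0 := hj
  exact he.apply_eq ⟨0, hj'⟩

theorem eigenvalue_ne_zero (he : IsWeightVector ρ a e) (hv : ∀ k, v k ≠ 0) (j : Fin n) :
    a j ≠ 0 := by
  intro h0
  have happly := he.apply_eq j
  rw [h0, zero_smul] at happly
  exact he.ne_zero ((map_eq_zero_iff _ (jucysMurphy_injective hv j j.isLt)).1 happly)

theorem conj_apply_eq (he : IsWeightVector ρ a e) {i j : Fin n} (hij : (i : ℕ) + 1 = j) :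
    (ρ (sigma q v ⟨i, by omega⟩) * ρ (jucysMurphy q v i i.isLt) *
      ρ (sigma q v ⟨i, by omega⟩)) e = a j • e := by
  rw [← map_jucysMurphy_succ ρ hij, he.apply_eq j]

end IsWeightVector

end Representations

section Spectrum

variable {K : Type u} [Field K] {m n : ℕ} {q : K} {v : Fin m → K}
  {V : Type u} [AddCommGroup V] [Module K V] {ρ : HeckeAlgebra n q v →ₐ[K] Module.End K V}
  {a : Fin n → K} {e : V}

namespace IsWeightVector

theorem eigenvalue_ne_succ (he : IsWeightVector ρ a e) (hg : IsGeneric n q v)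
    (hρ : IsCRepresentation ρ) {i j : Fin n} (hij : (i : ℕ) + 1 = j) : a i ≠ a j := by
  intro hab
  set X := ρ (jucysMurphy q v i i.isLt)
  set S := ρ (sigma q v ⟨i, by omega⟩)
  have hXS : X (S e) = a j • S e - ((q - q⁻¹) * a j) • e :=
    apply_apply_of_conj_apply (map_sigma_mul_self ρ _) (he.conj_apply_eq hij)
  have heig : X (S e) = a j • S e := by
    refine apply_eq_smul_of_sub_mem_eigenspace (hρ.diagonalizable i i.isLt) ?_
    rw [hXS, sub_sub_cancel_left, ← hab]
    exact neg_mem (Submodule.smul_mem _ _ (Module.End.mem_eigenspace_iff.2 (he.apply_eq i)))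
  rw [heig, eq_comm, sub_eq_self, smul_eq_zero_iff_left he.ne_zero] at hXS
  exact mul_ne_zero hg.sub_inv_ne_zero (he.eigenvalue_ne_zero hg.v_ne_zero j) hXS

theorem intertwine_comp_swap (he : IsWeightVector ρ a e) (hg : IsGeneric n q v)
    (hρ : IsCRepresentation ρ) {i j : Fin n} (hij : (i : ℕ) + 1 = j)
    (hlink : ¬ IsLinked q (a i) (a j)) :
    IsWeightVector ρ (a ∘ Equiv.swap i j)
      (intertwine q (ρ (sigma q v ⟨i, by omega⟩)) (a i) (a j) e) where
  ne_zero h := hlink (isLinked_of_intertwine_eq_zero hg.q_ne_zero (map_sigma_mul_self ρ _)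
    (he.eigenvalue_ne_succ hg hρ hij) he.ne_zero h)
  apply_eq k := by
    have hS := map_sigma_mul_self ρ ⟨i, by omega⟩
    have hY := he.conj_apply_eq hij
    have hab := he.eigenvalue_ne_succ hg hρ hij
    rw [Function.comp_apply]
    rcases eq_or_ne k i with rfl | hki
    · rw [Equiv.swap_apply_left]
      exact apply_intertwine hS (he.apply_eq k) hY hab
    rcases eq_or_ne k j with rfl | hkj
    · rw [Equiv.swap_apply_right, map_jucysMurphy_succ ρ hij]
      exact conj_apply_intertwine hS (he.apply_eq i) hY hab
    · have hcomm : Commute (sigma q v ⟨i, by omega⟩) (jucysMurphy q v k k.isLt) :=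
        sigma_commute_jucysMurphy q v k.isLt (fun h => hki (Fin.ext h))
          fun h => hkj (Fin.ext (h.trans hij))
      have happly := LinearMap.congr_fun (hcomm.map ρ).eq e
      rw [Module.End.mul_apply, Module.End.mul_apply, he.apply_eq k, map_smul] at happly
      rw [Equiv.swap_apply_of_ne_of_ne hki hkj, intertwine, map_sub, map_smul, ← happly,
        he.apply_eq k, smul_sub, smul_comm]

theorem sigma_apply_eq (he : IsWeightVector ρ a e) (hg : IsGeneric n q v)
    (hρ : IsCRepresentation ρ) {i j : Fin n} (hij : (i : ℕ) + 1 = j)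
    (hlink : IsLinked q (a i) (a j)) :
    ρ (sigma q v ⟨i, by omega⟩) e = diagCoeff q (a i) (a j) • e := by
  have hss := hρ.completely_reducible i (by omega)
  rw [jucysMurphy_succ, map_mul, map_mul] at hss
  exact sub_eq_zero.1 (intertwine_eq_zero_of_isLinked hg.q_ne_zero (map_sigma_mul_self ρ _) hss
    (he.apply_eq i) (he.conj_apply_eq hij) (he.eigenvalue_ne_succ hg hρ hij) hlink)

/- On such an `e` both `σ_i` and `σ_{i+1}` would be scalars `c` and `c'` with `c * c' = -1`, and
the braid relation would force `c = c'`; this happens only for `q ^ 2 = -1`. -/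
theorem not_isLinked_of_eq (he : IsWeightVector ρ a e) (hg : IsGeneric n q v)
    (hρ : IsCRepresentation ρ) {i j k : Fin n} (hij : (i : ℕ) + 1 = j) (hjk : (j : ℕ) + 1 = k)
    (hik : a i = a k) : ¬ IsLinked q (a i) (a j) := by
  intro hlink
  have hab := he.eigenvalue_ne_succ hg hρ hij
  have hs := he.sigma_apply_eq hg hρ hij hlink
  have ht := he.sigma_apply_eq hg hρ hjk (hik ▸ hlink.symm)
  rw [← hik] at ht
  have hmul : 1 + diagCoeff q (a i) (a j) * diagCoeff q (a j) (a i) = 0 :=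
    (one_add_diagCoeff_mul_swap_eq_zero_iff hg.q_ne_zero hab).2 hlink
  have heq : diagCoeff q (a i) (a j) = diagCoeff q (a j) (a i) := by
    have hbraid := congrArg (fun x => ρ x e)
      (sigma_braid q v (i := ⟨i, by omega⟩) (j := ⟨j, by omega⟩) hij)
    simp only [map_mul, Module.End.mul_apply, hs, ht, map_smul, smul_smul] at hbraid
    linear_combination (diagCoeff q (a i) (a j) - diagCoeff q (a j) (a i)) * hmul -
      smul_left_injective K he.ne_zero hbraid
  have hadd : a i + a j = 0 := by
    have hmulsub := diagCoeff_mul_sub (q := q) hab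
    have hmulsub' := diagCoeff_mul_sub (q := q) hab.symm
    refine (mul_eq_zero_iff_left hg.sub_inv_ne_zero).1 ?_
    linear_combination (a j - a i) * heq - hmulsub - hmulsub'
  have hne := he.eigenvalue_ne_zero hg.v_ne_zero
  have hsq := hg.one_add_sq_ne_zero (by omega)
  rcases hlink with h | h
  · exact mul_ne_zero hsq (hne i) (by linear_combination hadd - h)
  · exact mul_ne_zero hsq (hne j) (by linear_combination hadd - h)

end IsWeightVector

theorem isTranspositionClosed_weights (hg : IsGeneric n q v) (hρ : IsCRepresentation ρ) :
    IsTranspositionClosed q v {a | ∃ e, IsWeightVector ρ a e} where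
  start := fun _ ⟨_, he⟩ _ hj => he.eigenvalue_zero_mem_range hj
  ne_succ := fun _ ⟨_, he⟩ _ _ hij => he.eigenvalue_ne_succ hg hρ hij
  swap_mem := fun _ ⟨_, he⟩ _ _ hij hlink => ⟨_, he.intertwine_comp_swap hg hρ hij hlink⟩
  not_isLinked := fun _ ⟨_, he⟩ _ _ _ hij hjk hik => he.not_isLinked_of_eq hg hρ hij hjk hik

theorem isLocalContent_of_mem_jmSpec (hg : IsGeneric n q v) (ha : a ∈ jmSpec n q v) :
    IsLocalContent q v a := by
  obtain ⟨V, _, _, _, ρ, hρ, e, h0, he⟩ := ha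
  exact (isTranspositionClosed_weights hg hρ).isLocalContent hg.q_ne_zero ⟨e, h0, he⟩

end Spectrum

/-! ### Transpositions of content strings -/

section Transpositions

variable {K : Type u} [Field K] {m n : ℕ} {q : K} {v : Fin m → K} {a : Fin n → K} {i j : Fin n}

theorem comp_swap_comp_swap {α β : Type*} [DecidableEq α] (f : α → β) (i j : α) :
    (f ∘ Equiv.swap i j) ∘ Equiv.swap i j = f := by
  funext k
  simp

theorem comp_swap_comm {α β : Type*} [DecidableEq α] {i j k l : α} (hik : i ≠ k) (hil : i ≠ l)
    (hjk : j ≠ k) (hjl : j ≠ l) (f : α → β) :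
    (f ∘ Equiv.swap i j) ∘ Equiv.swap k l = (f ∘ Equiv.swap k l) ∘ Equiv.swap i j := by
  funext p
  simp only [Function.comp_apply]
  congr 1
  simp only [Equiv.swap_apply_def]
  split_ifs <;> simp_all

theorem comp_swap_braid {α β : Type*} [DecidableEq α] {i j k : α} (hij : i ≠ j) (hjk : j ≠ k)
    (hik : i ≠ k) (f : α → β) :
    ((f ∘ Equiv.swap i j) ∘ Equiv.swap j k) ∘ Equiv.swap i j =
      ((f ∘ Equiv.swap j k) ∘ Equiv.swap i j) ∘ Equiv.swap j k := by
  funext p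
  simp only [Function.comp_apply]
  congr 1
  simp only [Equiv.swap_apply_def]
  split_ifs <;> simp_all

theorem swap_succ_lt_or (hij : (i : ℕ) + 1 = j) {r t : Fin n} (h : r < t) :
    Equiv.swap i j r < Equiv.swap i j t ∨ r = i ∧ t = j := by
  simp only [Equiv.swap_apply_def]
  split_ifs <;> simp only [Fin.lt_def, Fin.ext_iff] at * <;> omega

theorem swap_lt_swap_of_isLinked (hij : (i : ℕ) + 1 = j) (hlink : ¬ IsLinked q (a i) (a j))
    {r t : Fin n} (hrt : r < t) (h : IsLinked q (a r) (a t)) :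
    Equiv.swap i j r < Equiv.swap i j t :=
  (swap_succ_lt_or hij hrt).resolve_right fun ⟨hr, ht⟩ => hlink (hr ▸ ht ▸ h)

namespace IsLocalContent

theorem zero_mem_range (ha : IsLocalContent q v a) (hj : (j : ℕ) = 0) : a j ∈ Set.range v :=
  (ha.start j).resolve_right fun ⟨i, hi, _⟩ => by rw [Fin.lt_def] at hi; omega

theorem ne_succ (ha : IsLocalContent q v a) (hij : (i : ℕ) + 1 = j) : a i ≠ a j := by
  intro e
  obtain ⟨⟨k, ⟨hik, hkj⟩, -⟩, -⟩ := ha.gap i j (Fin.lt_def.2 (by omega)) e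
  rw [Fin.lt_def] at hik hkj
  omega

theorem ne_succ_succ (ha : IsLocalContent q v a) (hg : IsGeneric n q v) {k : Fin n}
    (hij : (i : ℕ) + 1 = j) (hjk : (j : ℕ) + 1 = k) : a i ≠ a k := by
  intro e
  have eq_mid {p : Fin n} (hp : p ∈ Set.Ioo i k) : p = j := by
    have hip : (i : ℕ) < p := hp.1
    have hpk : (p : ℕ) < k := hp.2
    exact Fin.ext (by omega)
  obtain ⟨⟨p, hp, hup⟩, p', hp', hdown⟩ := ha.gap i k (Fin.lt_def.2 (by omega)) e
  rw [eq_mid hp] at hup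
  rw [eq_mid hp', hup] at hdown
  refine hg.zpow_ne_one 2 two_ne_zero (by rw [abs_two]; norm_cast; omega) ?_
  refine mul_right_cancel₀ (ha.ne_zero hg.q_ne_zero hg.v_ne_zero i) ?_
  calc q ^ (2 * 2 : ℤ) * a i = q ^ 2 * (q ^ 2 * a i) := by norm_cast; ring
    _ = 1 * a i := by rw [← hdown, one_mul]

theorem comp_swap (ha : IsLocalContent q v a) (hij : (i : ℕ) + 1 = j)
    (hlink : ¬ IsLinked q (a i) (a j)) : IsLocalContent q v (a ∘ Equiv.swap i j) where
  start p := (ha.start (Equiv.swap i j p)).imp id fun ⟨r, hr, h⟩ =>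
    ⟨Equiv.swap i j r, by simpa using swap_lt_swap_of_isLinked hij hlink hr h, by simpa using h⟩
  gap p t hpt e := by
    rw [Function.comp_apply, Function.comp_apply] at e
    have hlt : Equiv.swap i j p < Equiv.swap i j t :=
      (swap_succ_lt_or hij hpt).resolve_right (by
        rintro ⟨rfl, rfl⟩
        exact ha.ne_succ hij (by simpa using e.symm))
    have mem_Ioo {k : Fin n} (hk : k ∈ Set.Ioo (Equiv.swap i j p) (Equiv.swap i j t))
        (h : IsLinked q (a (Equiv.swap i j p)) (a k)) : Equiv.swap i j k ∈ Set.Ioo p t :=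
      ⟨by simpa using swap_lt_swap_of_isLinked hij hlink hk.1 h,
        by simpa using swap_lt_swap_of_isLinked hij hlink hk.2 (e ▸ h.symm)⟩
    obtain ⟨⟨k, hk, hup⟩, l, hl, hdown⟩ := ha.gap _ _ hlt e
    exact ⟨⟨Equiv.swap i j k, mem_Ioo hk (Or.inl hup), by simpa using hup⟩,
      Equiv.swap i j l, mem_Ioo hl (Or.inr hdown), by simpa using hdown⟩

end IsLocalContent

theorem finite_setOf_isLocalContent (hq : q ≠ 0) :
    {a : Fin n → K | IsLocalContent q v a}.Finite := by
  have hfin : (Set.image2 (fun (k : Fin m) (z : ℤ) => v k * q ^ (2 * z)) Set.univ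
      (Set.Icc (-n : ℤ) n)).Finite := Set.Finite.image2 _ Set.finite_univ (Set.finite_Icc _ _)
  refine (Set.Finite.pi' fun _ : Fin n => hfin).subset fun a ha j => ?_
  obtain ⟨k, z, hz, hj⟩ := ha.exists_entry hq j
  exact ⟨k, trivial, z, abs_le.1 (hz.trans (Int.ofNat_le.2 j.2.le)), hj.symm⟩

end Transpositions

section Coefficients

variable {K : Type u} [Field K] {q : K}

open Classical in
/-- The off-diagonal coefficient of Young's seminormal form; see `diagCoeff`. It is set to zero at
both linked pairs `(x, y)` and `(y, x)`, although the formula gives zero at only one of them. -/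
noncomputable def offCoeff (q x y : K) : K :=
  if IsLinked q x y then 0 else q⁻¹ * (y - q ^ 2 * x) / (y - x)

theorem offCoeff_eq_zero {x y : K} (h : IsLinked q x y) : offCoeff q x y = 0 :=
  if_pos h

theorem offCoeff_mul_swap (hq : q ≠ 0) {x y : K} (h : x ≠ y) :
    offCoeff q x y * offCoeff q y x = 1 + diagCoeff q x y * diagCoeff q y x := by
  by_cases hlink : IsLinked q x y
  · rw [offCoeff_eq_zero hlink, zero_mul, (one_add_diagCoeff_mul_swap_eq_zero_iff hq h).2 hlink]
  · rw [offCoeff, offCoeff, if_neg hlink, if_neg fun h => hlink h.symm,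
      one_add_diagCoeff_mul_swap hq h]

theorem diagCoeff_triple {x y z : K} (hxy : x ≠ y) (hyz : y ≠ z) (hxz : x ≠ z) :
    diagCoeff q x y * diagCoeff q y z + diagCoeff q x z * diagCoeff q y x =
      diagCoeff q y z * diagCoeff q x z := by
  have hyx : y - x ≠ 0 := sub_ne_zero.2 hxy.symm
  have hzy : z - y ≠ 0 := sub_ne_zero.2 hyz.symm
  have hzx : z - x ≠ 0 := sub_ne_zero.2 hxz.symm
  simp only [diagCoeff]
  rw [← neg_sub y x]
  generalize q - q⁻¹ = t
  field_simp
  ring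

end Coefficients

/-! ### The seminormal representation -/

section Seminormal

variable {K : Type u} [Field K] {m n : ℕ} {q : K} {v : Fin m → K} {a : Fin n → K}

/-- Young's seminormal form of `σ`, exchanging the positions `i` and `j`, on functions of
strings. -/
noncomputable def sigmaOp (q : K) (i j : Fin n) : Module.End K ((Fin n → K) → K) :=
  LinearMap.mulLeft K (fun a : Fin n → K => diagCoeff q (a i) (a j)) +
    LinearMap.mulLeft K (fun a : Fin n → K => offCoeff q (a i) (a j)) *
      LinearMap.funLeft K K (· ∘ Equiv.swap i j)

/-- The space of the seminormal representation: functions supported on the content strings. -/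
def contentModule (n : ℕ) (q : K) (v : Fin m → K) : Submodule K ((Fin n → K) → K) :=
  Submodule.pi {a | ¬ IsLocalContent q v a} fun _ => ⊥

theorem mem_contentModule_iff {f : (Fin n → K) → K} :
    f ∈ contentModule n q v ↔ ∀ a, ¬ IsLocalContent q v a → f a = 0 :=
  Iff.rfl

theorem contentModule_ext {f g : contentModule n q v}
    (h : ∀ a, IsLocalContent q v a → f.1 a = g.1 a) : f = g := by
  refine Subtype.ext (funext fun a => ?_)
  by_cases ha : IsLocalContent q v a
  · exact h a ha
  · rw [mem_contentModule_iff.1 f.2 a ha, mem_contentModule_iff.1 g.2 a ha]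

theorem sigmaOp_mem_contentModule {i j : Fin n} (hij : (i : ℕ) + 1 = j) :
    ∀ f ∈ contentModule n q v, sigmaOp q i j f ∈ contentModule n q v := by
  intro f hf
  rw [mem_contentModule_iff] at hf ⊢
  intro a ha
  change diagCoeff q (a i) (a j) * f a + offCoeff q (a i) (a j) * f (a ∘ Equiv.swap i j) = 0
  rw [hf a ha, mul_zero, zero_add]
  by_cases hlink : IsLinked q (a i) (a j)
  · rw [offCoeff_eq_zero hlink, zero_mul]
  · rw [hf _ fun hswap => ha ?_, mul_zero]
    rw [← comp_swap_comp_swap a i j]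
    exact hswap.comp_swap hij (by simpa using fun h => hlink h.symm)

theorem mulLeft_mem_contentModule (g : (Fin n → K) → K) :
    ∀ f ∈ contentModule n q v, LinearMap.mulLeft K g f ∈ contentModule n q v :=
  fun _ hf a ha => mul_eq_zero_of_right (g a) (hf a ha)

/-- The action of `σ` in the seminormal representation, for neighbouring positions `i` and `j`. -/
noncomputable def sigmaEnd (q : K) (v : Fin m → K) (i j : Fin n) (hij : (i : ℕ) + 1 = j) :
    Module.End K (contentModule n q v) :=
  (sigmaOp q i j).restrict (sigmaOp_mem_contentModule hij)

/-- The action of a Jucys–Murphy element in the seminormal representation: multiplication by an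
entry of the string. -/
def entryEnd (q : K) (v : Fin m → K) (i : Fin n) : Module.End K (contentModule n q v) :=
  (LinearMap.mulLeft K fun a : Fin n → K => a i).restrict (mulLeft_mem_contentModule _)

theorem sigmaEnd_apply {i j : Fin n} (hij : (i : ℕ) + 1 = j) (f : contentModule n q v)
    (a : Fin n → K) : (sigmaEnd q v i j hij f).1 a =
      diagCoeff q (a i) (a j) * f.1 a + offCoeff q (a i) (a j) * f.1 (a ∘ Equiv.swap i j) :=
  rfl

theorem entryEnd_apply (i : Fin n) (f : contentModule n q v) (a : Fin n → K) :
    (entryEnd q v i f).1 a = a i * f.1 a :=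
  rfl

theorem entryEnd_commute (i j : Fin n) : Commute (entryEnd q v i) (entryEnd q v j) :=
  LinearMap.ext fun _ => contentModule_ext fun _ _ => mul_left_comm _ _ _

theorem sigmaEnd_mul_self (hq : q ≠ 0) {i j : Fin n} (hij : (i : ℕ) + 1 = j) :
    sigmaEnd q v i j hij * sigmaEnd q v i j hij = (q - q⁻¹) • sigmaEnd q v i j hij + 1 := by
  refine LinearMap.ext fun f => contentModule_ext fun a ha => ?_
  change _ = (q - q⁻¹) * (sigmaEnd q v i j hij f).1 a + f.1 a
  have hab := ha.ne_succ hij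
  simp only [Module.End.mul_apply, sigmaEnd_apply, comp_swap_comp_swap, Function.comp_apply,
    Equiv.swap_apply_left, Equiv.swap_apply_right]
  rw [← diagCoeff_add_swap hab]
  linear_combination f.1 a * offCoeff_mul_swap hq hab

theorem sigmaEnd_mul_entryEnd_mul_sigmaEnd (hq : q ≠ 0) {i j : Fin n} (hij : (i : ℕ) + 1 = j) :
    sigmaEnd q v i j hij * entryEnd q v i * sigmaEnd q v i j hij = entryEnd q v j := by
  refine LinearMap.ext fun f => contentModule_ext fun a ha => ?_
  simp only [Module.End.mul_apply, sigmaEnd_apply, entryEnd_apply, comp_swap_comp_swap,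
    Function.comp_apply, Equiv.swap_apply_left, Equiv.swap_apply_right]
  linear_combination f.1 a * a j * offCoeff_mul_swap hq (ha.ne_succ hij) +
    (f.1 a * diagCoeff q (a i) (a j) + offCoeff q (a i) (a j) * f.1 (a ∘ Equiv.swap i j)) *
      mul_diagCoeff_add_swap (q := q) (a i) (a j)

theorem sigmaEnd_braid (hg : IsGeneric n q v) {i j k : Fin n} (hij : (i : ℕ) + 1 = j)
    (hjk : (j : ℕ) + 1 = k) :
    sigmaEnd q v i j hij * sigmaEnd q v j k hjk * sigmaEnd q v i j hij =
      sigmaEnd q v j k hjk * sigmaEnd q v i j hij * sigmaEnd q v j k hjk := by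
  have hi : i ≠ j := Fin.ne_of_val_ne (by omega)
  have hj : j ≠ k := Fin.ne_of_val_ne (by omega)
  have hk : i ≠ k := Fin.ne_of_val_ne (by omega)
  refine LinearMap.ext fun f => contentModule_ext fun a ha => ?_
  simp only [Module.End.mul_apply, sigmaEnd_apply, comp_swap_comp_swap, comp_swap_braid hi hj hk,
    Function.comp_apply, Equiv.swap_apply_left, Equiv.swap_apply_right,
    Equiv.swap_apply_of_ne_of_ne hi hk, Equiv.swap_apply_of_ne_of_ne hk.symm hj.symm]
  have hxy := ha.ne_succ hij
  have hyz := ha.ne_succ hjk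
  have off_xy := offCoeff_mul_swap hg.q_ne_zero hxy
  have off_yz := offCoeff_mul_swap hg.q_ne_zero hyz
  have triple := diagCoeff_triple (q := q) hxy hyz (ha.ne_succ_succ hg hij hjk)
  have triple' : diagCoeff q (a j) (a k) * diagCoeff q (a i) (a j) +
      diagCoeff q (a i) (a k) * diagCoeff q (a k) (a j) =
        diagCoeff q (a i) (a j) * diagCoeff q (a i) (a k) := by
    linear_combination triple + diagCoeff q (a i) (a k) *
      (diagCoeff_add_swap (q := q) hyz - diagCoeff_add_swap (q := q) hxy)
  linear_combination (f.1 a * diagCoeff q (a i) (a k)) * (off_xy - off_yz) +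
    (f.1 (a ∘ Equiv.swap i j) * offCoeff q (a i) (a j)) * triple -
    (f.1 (a ∘ Equiv.swap j k) * offCoeff q (a j) (a k)) * triple' +
    f.1 a * (diagCoeff q (a i) (a j) * triple - diagCoeff q (a j) (a k) * triple')

theorem sigmaEnd_commute {i j k l : Fin n} (hij : (i : ℕ) + 1 = j) (hkl : (k : ℕ) + 1 = l)
    (hjk : j < k) : Commute (sigmaEnd q v i j hij) (sigmaEnd q v k l hkl) := by
  rw [Fin.lt_def] at hjk
  have hik : i ≠ k := Fin.ne_of_val_ne (by omega)
  have hil : i ≠ l := Fin.ne_of_val_ne (by omega)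
  have hjk : j ≠ k := Fin.ne_of_val_ne (by omega)
  have hjl : j ≠ l := Fin.ne_of_val_ne (by omega)
  refine LinearMap.ext fun f => contentModule_ext fun a _ => ?_
  simp only [Module.End.mul_apply, sigmaEnd_apply, comp_swap_comm hik hil hjk hjl,
    Function.comp_apply, Equiv.swap_apply_of_ne_of_ne hik hil,
    Equiv.swap_apply_of_ne_of_ne hjk hjl, Equiv.swap_apply_of_ne_of_ne hik.symm hjk.symm,
    Equiv.swap_apply_of_ne_of_ne hil.symm hjl.symm]
  ring

theorem entryEnd_commute_sigmaEnd {i j k : Fin n} (hij : (i : ℕ) + 1 = j) (hki : k ≠ i)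
    (hkj : k ≠ j) : Commute (entryEnd q v k) (sigmaEnd q v i j hij) := by
  refine LinearMap.ext fun f => contentModule_ext fun a _ => ?_
  simp only [Module.End.mul_apply, sigmaEnd_apply, entryEnd_apply, Function.comp_apply,
    Equiv.swap_apply_of_ne_of_ne hki hkj]
  ring

theorem entryEnd_sigmaEnd_braid (hq : q ≠ 0) {i j : Fin n} (hij : (i : ℕ) + 1 = j) :
    entryEnd q v i * sigmaEnd q v i j hij * entryEnd q v i * sigmaEnd q v i j hij =
      sigmaEnd q v i j hij * entryEnd q v i * sigmaEnd q v i j hij * entryEnd q v i := by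
  have hcomm := (entryEnd_commute (q := q) (v := v) i j).eq
  rw [← sigmaEnd_mul_entryEnd_mul_sigmaEnd hq hij] at hcomm
  simpa only [mul_assoc] using hcomm

open Classical in
/-- The basis vector of the seminormal representation at a content string. -/
noncomputable def contentVector (a : Fin n → K) (ha : IsLocalContent q v a) :
    contentModule n q v :=
  ⟨Pi.single a 1, fun _ hb => Pi.single_eq_of_ne (fun h => hb (by rwa [h])) _⟩

theorem contentVector_self (ha : IsLocalContent q v a) : (contentVector a ha).1 a = 1 := by
  simp [contentVector]

theorem contentVector_of_ne (ha : IsLocalContent q v a) {b : Fin n → K} (h : b ≠ a) :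
    (contentVector a ha).1 b = 0 := by
  simp [contentVector, h]

theorem contentVector_ne_zero (ha : IsLocalContent q v a) : contentVector a ha ≠ 0 := fun h =>
  zero_ne_one ((congrArg (fun f => f.1 a) h).symm.trans (contentVector_self ha))

theorem span_range_contentVector (hq : q ≠ 0) : Submodule.span K
    (Set.range fun a : {a : Fin n → K // IsLocalContent q v a} => contentVector a.1 a.2) = ⊤ := by
  have : Fintype {a : Fin n → K // IsLocalContent q v a} :=
    (finite_setOf_isLocalContent hq).fintype
  refine eq_top_iff.2 fun f _ => ?_
  have hf : f = ∑ a : {a : Fin n → K // IsLocalContent q v a}, f.1 a.1 • contentVector a.1 a.2 := by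
    refine contentModule_ext fun b hb => ?_
    rw [Submodule.coe_sum, Finset.sum_apply, Fintype.sum_eq_single ⟨b, hb⟩]
    · rw [Submodule.coe_smul, Pi.smul_apply, contentVector_self, smul_eq_mul, mul_one]
    · intro a hab
      rw [Submodule.coe_smul, Pi.smul_apply,
        contentVector_of_ne _ fun h => hab (Subtype.ext h.symm), smul_zero]
  rw [hf]
  exact Submodule.sum_mem _ fun a _ => Submodule.smul_mem _ _ (Submodule.subset_span ⟨a, rfl⟩)

theorem finiteDimensional_contentModule (hq : q ≠ 0) :
    FiniteDimensional K (contentModule n q v) := by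
  have : Finite {a : Fin n → K // IsLocalContent q v a} := finite_setOf_isLocalContent hq
  refine Module.finite_def.2 ?_
  rw [← span_range_contentVector hq]
  exact Submodule.fg_span (Set.finite_range _)

theorem entryEnd_contentVector (ha : IsLocalContent q v a) (i : Fin n) :
    entryEnd q v i (contentVector a ha) = a i • contentVector a ha := by
  refine contentModule_ext fun b _ => ?_
  change b i * (contentVector a ha).1 b = a i * (contentVector a ha).1 b
  rcases eq_or_ne b a with rfl | hb
  · rfl
  · rw [contentVector_of_ne ha hb, mul_zero, mul_zero]

theorem intertwine_contentVector_eq_zero (ha : IsLocalContent q v a) {i j : Fin n}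
    (hij : (i : ℕ) + 1 = j) (hlink : IsLinked q (a i) (a j)) :
    intertwine q (sigmaEnd q v i j hij) (a i) (a j) (contentVector a ha) = 0 := by
  refine sub_eq_zero.2 (contentModule_ext fun b _ => ?_)
  have hoff : offCoeff q (b i) (b j) * (contentVector a ha).1 (b ∘ Equiv.swap i j) = 0 := by
    rcases eq_or_ne (b ∘ Equiv.swap i j) a with rfl | hba
    · rw [offCoeff_eq_zero (by simpa using hlink.symm), zero_mul]
    · rw [contentVector_of_ne ha hba, mul_zero]
  rw [sigmaEnd_apply, hoff, add_zero]
  change _ = diagCoeff q (a i) (a j) * (contentVector a ha).1 b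
  rcases eq_or_ne b a with rfl | hb
  · rfl
  · rw [contentVector_of_ne ha hb, mul_zero, mul_zero]

theorem prod_entryEnd_sub (hq : q ≠ 0) {j : Fin n} (hj : (j : ℕ) = 0) : (List.ofFn fun k =>
    entryEnd q v j - algebraMap K (Module.End K (contentModule n q v)) (v k)).prod = 0 := by
  refine LinearMap.ext_on (span_range_contentVector hq) ?_
  rintro _ ⟨⟨a, ha⟩, rfl⟩
  obtain ⟨k, hk⟩ := ha.zero_mem_range hj
  rw [prod_ofFn_sub_apply _ _ (entryEnd_contentVector ha j),
    Finset.prod_eq_zero (Finset.mem_univ k) (sub_eq_zero.2 hk.symm), zero_smul,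
    LinearMap.zero_apply]

/-- The images of the generators of the Hecke algebra in the seminormal representation. -/
noncomputable def seminormalGen (q : K) (v : Fin m → K) (hn : 0 < n) :
    Gen n → Module.End K (contentModule n q v)
  | Gen.tau => entryEnd q v ⟨0, hn⟩
  | Gen.sigma i => sigmaEnd q v ⟨i, by omega⟩ ⟨i + 1, by omega⟩ rfl

theorem lift_seminormalGen_eq_of_rel (hg : IsGeneric n q v) (hn : 0 < n)
    {x y : FreeAlgebra K (Gen n)} (h : Rel n q v x y) :
    FreeAlgebra.lift K (seminormalGen q v hn) x = FreeAlgebra.lift K (seminormalGen q v hn) y := by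
  have lift_tau : FreeAlgebra.lift K (seminormalGen q v hn) (freeTau K n) =
    entryEnd q v ⟨0, hn⟩ := FreeAlgebra.lift_ι_apply _ _
  have lift_sigma (i : Fin (n - 1)) : FreeAlgebra.lift K (seminormalGen q v hn) (freeSigma K i) =
    sigmaEnd (n := n) q v ⟨i, by omega⟩ ⟨i + 1, by omega⟩ rfl := FreeAlgebra.lift_ι_apply _ _
  cases h with
  | braid i j h =>
    obtain ⟨j, hj⟩ := j
    obtain rfl : (i : ℕ) + 1 = j := h
    simp only [map_mul, lift_sigma]
    exact sigmaEnd_braid hg rfl rfl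
  | far_comm i j h =>
    rw [map_mul, map_mul, lift_sigma, lift_sigma]
    exact sigmaEnd_commute rfl rfl h
  | tau_braid i h =>
    obtain ⟨i, hi⟩ := i
    obtain rfl : i = 0 := h
    simp only [map_mul, lift_tau, lift_sigma]
    exact entryEnd_sigmaEnd_braid hg.q_ne_zero rfl
  | tau_comm i h =>
    rw [map_mul, map_mul, lift_tau, lift_sigma]
    exact entryEnd_commute_sigmaEnd rfl (Fin.ne_of_val_ne h.ne) (Fin.ne_of_val_ne (by simp))
  | quadratic i =>
    rw [pow_two, map_mul, map_add, map_smul, map_one, lift_sigma]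
    exact sigmaEnd_mul_self hg.q_ne_zero rfl
  | cyclotomic =>
    simp only [map_list_prod, List.map_ofFn, Function.comp_def, map_sub, AlgHom.commutes,
      lift_tau, map_zero]
    exact prod_entryEnd_sub hg.q_ne_zero rfl

/-- The seminormal representation of the cyclotomic Hecke algebra on functions of content
strings; it is the sum of the seminormal representations of all `m`-partitions of `n`. -/
noncomputable def seminormal (hg : IsGeneric n q v) (hn : 0 < n) :
    HeckeAlgebra n q v →ₐ[K] Module.End K (contentModule n q v) :=
  RingQuot.liftAlgHom K ⟨FreeAlgebra.lift K (seminormalGen q v hn), fun _ _ h =>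
    lift_seminormalGen_eq_of_rel hg hn h⟩

theorem seminormal_tau (hg : IsGeneric n q v) (hn : 0 < n) :
    seminormal hg hn (tau q v) = entryEnd q v ⟨0, hn⟩ :=
  (RingQuot.liftAlgHom_mkAlgHom_apply ..).trans (FreeAlgebra.lift_ι_apply _ _)

theorem seminormal_sigma (hg : IsGeneric n q v) (hn : 0 < n) (i : Fin (n - 1)) :
    seminormal hg hn (sigma q v i) = sigmaEnd (n := n) q v ⟨i, by omega⟩ ⟨i + 1, by omega⟩ rfl :=
  (RingQuot.liftAlgHom_mkAlgHom_apply ..).trans (FreeAlgebra.lift_ι_apply _ _)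

theorem seminormal_jucysMurphy (hg : IsGeneric n q v) (hn : 0 < n) (i : ℕ) (hi : i < n) :
    seminormal hg hn (jucysMurphy q v i hi) = entryEnd q v ⟨i, hi⟩ := by
  induction i with
  | zero => exact seminormal_tau hg hn
  | succ i ih =>
    rw [jucysMurphy_succ, map_mul, map_mul, ih, seminormal_sigma]
    exact sigmaEnd_mul_entryEnd_mul_sigmaEnd hg.q_ne_zero rfl

theorem isCRepresentation_seminormal (hg : IsGeneric n q v) (hn : 0 < n) :
    IsCRepresentation (seminormal hg hn) where
  diagonalizable i hi := by
    rw [eq_top_iff, ← span_range_contentVector hg.q_ne_zero, Submodule.span_le,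
      seminormal_jucysMurphy]
    rintro _ ⟨⟨a, ha⟩, rfl⟩
    exact Submodule.mem_iSup_of_mem (a ⟨i, hi⟩)
      (Module.End.mem_eigenspace_iff.2 (entryEnd_contentVector ha _))
  completely_reducible i hi := by
    have hconj := sigmaEnd_mul_entryEnd_mul_sigmaEnd (v := v) hg.q_ne_zero
      (i := ⟨i, by omega⟩) (j := ⟨i + 1, hi⟩) rfl
    rw [seminormal_jucysMurphy, seminormal_jucysMurphy, seminormal_sigma, ← hconj]
    refine isSemisimpleModule_adjoin_of_span_eq_top (span_range_contentVector hg.q_ne_zero) ?_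
    rintro _ ⟨⟨a, ha⟩, rfl⟩
    exact isSimpleModule_span_of_eigenvector hg.q_ne_zero (sigmaEnd_mul_self hg.q_ne_zero rfl)
      (contentVector_ne_zero ha) (entryEnd_contentVector ha _)
      (hconj.symm ▸ entryEnd_contentVector ha _) (ha.ne_succ rfl)
      (intertwine_contentVector_eq_zero ha rfl)

theorem mem_jmSpec_of_isLocalContent (hg : IsGeneric n q v) (hn : 0 < n)
    (ha : IsLocalContent q v a) : a ∈ jmSpec n q v := by
  refine ⟨contentModule n q v, inferInstance, inferInstance,
    finiteDimensional_contentModule hg.q_ne_zero, seminormal hg hn,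
    isCRepresentation_seminormal hg hn, contentVector a ha, contentVector_ne_zero ha, fun i => ?_⟩
  rw [seminormal_jucysMurphy]
  exact entryEnd_contentVector ha i

end Seminormal

end CyclotomicHecke

theorem mainTheorem5 {K : Type u} [Field K] (m n : ℕ) (hn : 0 < n) (q : K) (v : Fin m → K)
    (hq0 : q ≠ 0) (hq1 : q ^ 2 ≠ 1)
    (h1 : ∀ N : ℕ, N < n → ∑ i ∈ Finset.range (N + 1), q ^ (2 * i) ≠ 0)
    (h2 : ∀ i : ℤ, -(n : ℤ) < i → i < (n : ℤ) → ∀ j k : Fin m, j ≠ k →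
      q ^ (2 * i) * v j - v k ≠ 0)
    (h3 : ∀ j : Fin m, v j ≠ 0) :
    CyclotomicHecke.jmSpec n q v = CyclotomicHecke.contentStrings n q v ∧
    Set.BijOn (CyclotomicHecke.StandardTableau.contentString q v)
      (Set.univ : Set (CyclotomicHecke.StandardTableau m n))
      (CyclotomicHecke.contentStrings n q v) ∧
    Set.BijOn (CyclotomicHecke.StandardTableau.contentString q v)
      (Set.univ : Set (CyclotomicHecke.StandardTableau m n))
      (CyclotomicHecke.jmSpec n q v) := by
  have hg := CyclotomicHecke.IsGeneric.of_sum_ne_zero hq0 hq1 h1 h2 h3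
  have hspec : CyclotomicHecke.jmSpec n q v = {a | CyclotomicHecke.IsLocalContent q v a} :=
    Set.ext fun a => ⟨CyclotomicHecke.isLocalContent_of_mem_jmSpec hg,
      CyclotomicHecke.mem_jmSpec_of_isLocalContent hg hn⟩
  have hbij := CyclotomicHecke.StandardTableau.bijOn_contentString hg
  rw [CyclotomicHecke.contentStrings_eq hg, hspec]
  exact ⟨rfl, hbij, hbij⟩
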